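/- **Theorem 1 (ProST-T dynamic regret).** *Setting.* Let $\mathcal S,\mathcal A$ be finite, $\gamma\in[0,1)$, $H\ge 0$ and $K\ge1$. For interaction times $\mathfrak t_1,\dots,\mathfrak t_K$ let $P_{(k)},R_{(k)}$ be the transition kernel and the real-valued reward function at time $\mathfrak t_k$ of a time-elapsing MDP. For every $k$ the agent runs in episode $k$ a stationary policy $\pi^{(k)}$ for $H$ steps in $(P_{(k)},R_{(k)})$ from the fixed state $s_0$, which yields $s^{(k)}_0=s_0,a^{(k)}_0,s^{(k)}_1,\dots$. For $1\le k\le K-1$, before episode $k+1$ it forecasts a model $(\widehat P_{(k+1)},\widehat R_{(k+1)})$ and computes $\widehat\pi^{(k+1)}=\pi^{(k+1)}$ from it. The forecast and the policy may depend in any measurable way on the past (and on internal randomness); $\widehat P_{(k+1)}(\cdot|s,a)$ is nonnegative with total mass at most $1$. *Values.* For a model $M=(P,R)$ let $V^{\pi}_{M,h}(s)$ be the expected discounted reward of $\pi$ over the steps $h,\dots,H-1$ from state $s$ at step $h$ (discounted from step $h$ on), $V^\pi_M=V^\pi_{M,0}$, $V^*_M$ the supremum of the $H$-step value over all (also step-dependent)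 policies, $V^\pi_{M,\infty}$ the infinite-horizon value, $V^{*}_{M,\infty}=\sup_\pi V^\pi_{M,\infty}$, $Q^{*}_{M,\infty}=R+\gamma PV^{*}_{M,\infty}$, and, for $\tau>0$, $V^\pi_{M,\tau}=V^\pi_{M,\infty}+\tau\,\mathbb E[\sum_{h\ge0}-\gamma^h\log\pi(a_h|s_h)]$, $Q^\pi_{M,\tau}=R+\gamma PV^\pi_{M,\tau}$, $Q^*_{M,\tau}=R+\gamma P\sup_\pi V^\pi_{M,\tau}$. Hats and the index $(k+1)$ refer to the forecast model and the true model of episode $k+1$. The dynamic regret is $$\mathfrak R=\sum_{k=1}^{K-1}\big(V^{*,(k+1)}(s_0)-V^{\widehat\pi^{(k+1)},(k+1)}(s_0)\big).$$ With $\widehat V_h^{(k+1)}$ the values of $\widehat\pi^{(k+1)}$ in the forecast model and $\widehat Q_h^{(k+1)}=\widehat R_{(k+1)}+\gamma\widehat P_{(k+1)}\widehat V_{h+1}^{(k+1)}$, put $$\iota^{(k+1)}_h=R_{(k+1)}+\gamma P_{(k+1)}\widehat V^{(k+1)}_{h+1}-\widehat Q^{(k+1)}_h,\qquad \bar\iota^{(k+1)}_\infty=R_{(k+1)}+\gamma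 P_{(k+1)}\widehat V^{*,(k+1)}_\infty-\widehat Q^{*,(k+1)}_\infty,$$ $$\iota^K_H=\sum_{k=1}^{K-1}\sum_{h=0}^{H-1}\gamma^h\iota^{(k+1)}_h(s^{(k+1)}_h,a^{(k+1)}_h),\qquad \bar\iota^K_\infty=\sum_{k=1}^{K-1}\|\bar\iota^{(k+1)}_\infty\|_\infty .$$ Let $r$ be the maximum of all $|R_{(k+1)}(s,a)|$ and $|\widehat R_{(k+1)}(s,a)|$, $1\le k\le K-1$, and let $\rho$ be the largest value over $k$ of $\max_{s,a}\widehat R_{(k+1)}^+(s,a)+\max_{s,a}\widehat R_{(k+1)}^-(s,a)$ (so $\rho\le1$ if the forecasted rewards lie in $[0,1]$). *Algorithms.* Let $\Delta_\pi\ge1$ and $\eta>0$. For each $k$, $\widehat\pi^{(k+1)}=\widehat\pi_{(\Delta_\pi)}$ results from $\Delta_\pi$ iterations in the forecast model, started from a policy $\widehat\pi_{(0)}=\widehat\pi^{[k]}_{(0)}$ with positive probabilities (ProST-T takes $\pi^{(k)}$). They are either (a) NPG: $\widehat\pi_{(g+1)}(a|s)\propto\widehat\pi_{(g)}(a|s)\exp\big(\tfrac{\eta}{1-\gamma}\widehat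 Q_\infty^{\widehat\pi_{(g)}}(s,a)\big)$; or (b) entropy-regularized NPG with $\tau>0$ and $\eta\le(1-\gamma)/\tau$: $\widehat\pi_{(g+1)}(a|s)\propto\widehat\pi_{(g)}(a|s)^{1-\eta\tau/(1-\gamma)}\exp\big(\tfrac{\eta}{1-\gamma}\widetilde Q_g(s,a)\big)$, where $\|\widetilde Q_g-\widehat Q_\tau^{\widehat\pi_{(g)}}\|_\infty\le\delta$. *Claim.* For every $p\in(0,1)$, in both cases, with probability at least $1-p/2$, $$\mathfrak R\le\mathfrak R_I+\mathfrak R_{II},\qquad \mathfrak R_I=\frac{\bar\iota^K_\infty}{1-\gamma}-\iota^K_H+C_p\sqrt{K-1},\qquad \mathfrak R_{II}=C_{II}[\Delta_\pi]\,(K-1),$$ where $C_p=\frac{4r}{1-\gamma}\sqrt{H\log(4/p)}$ and, in case (a), $$C_{II}[\Delta_\pi]=\Big(\frac{\rho}{(1-\gamma)^2}+\frac{L}{\eta}\Big)\frac1{\Delta_\pi}+\frac{4\gamma^Hr}{1-\gamma},\qquad L=\max_{k,s,a}\log\frac1{\widehat\pi^{[k]}_{(0)}(a|s)}$$ (so $L=\log|\mathcal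 A|$ for uniform initial policies), and in case (b) $$C_{II}[\Delta_\pi]=(\gamma+2)\big[(1-\eta\tau)^{\Delta_\pi-1}C_1+C_2\big]+\frac{4\gamma^Hr}{1-\gamma}+\frac{2\tau\log|\mathcal A|}{1-\gamma},\qquad C_2=\frac{2\delta}{1-\gamma}\Big(1+\frac{\gamma}{\eta\tau}\Big),$$ $$C_1=\max_k\Big(\|\widehat Q_\tau^{*,(k+1)}-\widehat Q_\tau^{\widehat\pi^{[k]}_{(0)}}\|_\infty+2\tau\Big(1-\frac{\eta\tau}{1-\gamma}\Big)\|\log\widehat\pi_\tau^{*,(k+1)}-\log\widehat\pi^{[k]}_{(0)}\|_\infty\Big),$$ with $\widehat\pi_\tau^{*,(k+1)}(a|s)\propto\exp(\widehat Q_\tau^{*,(k+1)}(s,a)/\tau)$ the optimal regularized policy. All maxima over $k$ run over $1\le k\le K-1$. -/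

import Mathlib

open MeasureTheory

noncomputable section

namespace ProST

variable {S A : Type*}

/-- A stationary stochastic policy `π : S → Δ(A)`. -/
abbrev Policy (S A : Type*) [Fintype A] : Type _ := S → stdSimplex ℝ A

/-- The kernel `P(s' | s, a)`, written `P s a s'`, and the reward `R(s, a)` of a tabular model. -/
structure Model (S A : Type*) where
  P : S → A → S → ℝ
  R : S → A → ℝ

variable [Fintype S] [Fintype A]

namespace Model

/-- `P(· | s, a)` is a probability distribution for all `s, a`. -/
def IsMDP (M : Model S A) : Prop :=
  (∀ s a s', 0 ≤ M.P s a s') ∧ ∀ s a, ∑ s', M.P s a s' = 1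

/-- `P(· | s, a)` is nonnegative with total mass at most one for all `s, a`.  Regularized count
estimates `n(s', s, a) / (λ + n(s, a))` have this property, and so has every MDP. -/
def IsSubMDP (M : Model S A) : Prop :=
  (∀ s a s', 0 ≤ M.P s a s') ∧ ∀ s a, ∑ s', M.P s a s' ≤ 1

/-- `(P V)(s, a) = ∑ s', P(s' | s, a) V(s')`. -/
def next (M : Model S A) (V : S → ℝ) (s : S) (a : A) : ℝ := ∑ s', M.P s a s' * V s'

/-- `E[f(s_h, a_h) | s_0 = s]` when `a_i ∼ π_i(· | s_i)` and `s_{i+1} ∼ P(· | s_i, a_i)`. -/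
def expect (M : Model S A) (f : S → A → ℝ) : ℕ → (ℕ → Policy S A) → S → ℝ
  | 0, π, s => ∑ a, (π 0 s).1 a * f s a
  | h + 1, π, s => ∑ a, (π 0 s).1 a * M.next (expect M f h fun i => π (i + 1)) s a

/-- Expected discounted reward `E[∑_{h < n} γ^h R(s_h, a_h) | s_0 = s]` of a (possibly
step-dependent) policy over `n` steps. -/
def value (M : Model S A) (γ : ℝ) (n : ℕ) (π : ℕ → Policy S A) (s : S) : ℝ :=
  ∑ h ∈ Finset.range n, γ ^ h * M.expect M.R h π s

/-- Optimal `n`-step value, over all step-dependent policies. -/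
def optValue (M : Model S A) (γ : ℝ) (n : ℕ) (s : S) : ℝ :=
  ⨆ π : ℕ → Policy S A, M.value γ n π s

/-- Infinite-horizon value of a stationary policy. -/
def valueInf (M : Model S A) (γ : ℝ) (π : Policy S A) (s : S) : ℝ :=
  ∑' h : ℕ, γ ^ h * M.expect M.R h (fun _ => π) s

/-- Infinite-horizon optimal value. -/
def optValueInf (M : Model S A) (γ : ℝ) (s : S) : ℝ := ⨆ π : Policy S A, M.valueInf γ π s

/-- Discounted entropy `E[∑_h -γ^h log π(a_h | s_h) | s_0 = s]`. -/
def entropy (M : Model S A) (γ : ℝ) (π : Policy S A) (s : S) : ℝ :=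
  ∑' h : ℕ, γ ^ h * M.expect (fun x a => -Real.log ((π x).1 a)) h (fun _ => π) s

/-- Entropy-regularized value `V_τ^π = V^π + τ 𝓗(·, π)`. -/
def softValue (M : Model S A) (γ τ : ℝ) (π : Policy S A) (s : S) : ℝ :=
  M.valueInf γ π s + τ * M.entropy γ π s

/-- Optimal entropy-regularized value. -/
def optSoftValue (M : Model S A) (γ τ : ℝ) (s : S) : ℝ := ⨆ π : Policy S A, M.softValue γ τ π s

/-- `(R + γ P V)(s, a)`. -/
def backup (M : Model S A) (γ : ℝ) (V : S → ℝ) : S → A → ℝ :=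
  fun s a => M.R s a + γ * M.next V s a

/-- `Q_∞^π`. -/
def qInf (M : Model S A) (γ : ℝ) (π : Policy S A) : S → A → ℝ := M.backup γ (M.valueInf γ π)

/-- `Q_∞^*`. -/
def optQInf (M : Model S A) (γ : ℝ) : S → A → ℝ := M.backup γ (M.optValueInf γ)

/-- `Q_τ^π`. -/
def softQ (M : Model S A) (γ τ : ℝ) (π : Policy S A) : S → A → ℝ :=
  M.backup γ (M.softValue γ τ π)

/-- `Q_τ^*`. -/
def optSoftQ (M : Model S A) (γ τ : ℝ) : S → A → ℝ := M.backup γ (M.optSoftValue γ τ)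

/-- The optimal policy of the entropy-regularized problem,
`π_τ^*(a | s) = exp(Q_τ^*(s, a) / τ) / ∑_b exp(Q_τ^*(s, b) / τ)`. -/
def optSoftPolicy (M : Model S A) (γ τ : ℝ) : S → A → ℝ := fun s a =>
  Real.exp (M.optSoftQ γ τ s a / τ) / ∑ b, Real.exp (M.optSoftQ γ τ s b / τ)

/-- `V_h^π`: the value from step `h` on, in an episode of `H` steps. -/
def stepValue (M : Model S A) (γ : ℝ) (H : ℕ) (π : Policy S A) (h : ℕ) : S → ℝ :=
  M.value γ (H - h) fun _ => π

/-- `Q_h^π = R + γ P V_{h+1}^π`. -/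
def stepQ (M : Model S A) (γ : ℝ) (H : ℕ) (π : Policy S A) (h : ℕ) : S → A → ℝ :=
  M.backup γ (M.stepValue γ H π (h + 1))

end Model

/-- Model prediction error `ι_h = R + γ P V̂_{h+1} - Q̂_h` of the forecast `M'` of `M`, where
`V̂` and `Q̂` are the values of `π` in `M'`. -/
def modelError (M M' : Model S A) (γ : ℝ) (H : ℕ) (π : Policy S A) (h : ℕ) : S → A → ℝ :=
  M.backup γ (M'.stepValue γ H π (h + 1)) - M'.stepQ γ H π h

/-- Optimal model prediction error `ῑ_∞ = R + γ P V̂^*_∞ - Q̂^*_∞`. -/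
def optModelError (M M' : Model S A) (γ : ℝ) : S → A → ℝ :=
  M.backup γ (M'.optValueInf γ) - M'.optQInf γ

/-- `π'(a | s) ∝ π(a | s)^(1 - ητ/(1-γ)) exp(η Q(s, a) / (1 - γ))`: one natural policy gradient
update in the softmax parametrization, without regularization if `τ = 0`. -/
def IsNPGStep (γ η τ : ℝ) (π : Policy S A) (Q : S → A → ℝ) (π' : Policy S A) : Prop :=
  ∀ s a, (π' s).1 a =
    (π s).1 a ^ (1 - η * τ / (1 - γ)) * Real.exp (η * Q s a / (1 - γ)) /
      ∑ b, (π s).1 b ^ (1 - η * τ / (1 - γ)) * Real.exp (η * Q s b / (1 - γ))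

/-- `π` is the `n`-th iterate of NPG in the model `M` with exact values, from the policy `π₀`. -/
def IsNPG (M : Model S A) (γ η : ℝ) (n : ℕ) (π₀ π : Policy S A) : Prop :=
  ∃ it : ℕ → Policy S A, it 0 = π₀ ∧ it n = π ∧
    ∀ g < n, IsNPGStep γ η 0 (it g) (M.qInf γ (it g)) (it (g + 1))

/-- `π` is the `n`-th iterate of entropy-regularized NPG in the model `M` from the policy `π₀`,
where each soft Q-function is only evaluated up to an error `δ` in sup norm. -/
def IsSoftNPG (M : Model S A) (γ η τ δ : ℝ) (n : ℕ) (π₀ π : Policy S A) : Prop :=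
  ∃ (it : ℕ → Policy S A) (Q : ℕ → S → A → ℝ), it 0 = π₀ ∧ it n = π ∧
    ∀ g < n, ‖Q g - M.softQ γ τ (it g)‖ ≤ δ ∧ IsNPGStep γ η τ (it g) (Q g) (it (g + 1))

/-- `K` episodes of `H` steps in the environments `env 1, …, env K`, all started in `s₀`.

`ℱ (k, h)` is the information available when the action of step `h` of episode `k` is drawn; it may
contain internal randomness of the agent.  Given `ℱ (k, h)`, the action `a_h` has the law
`π^(k)(· | s_h)`, and, given `a_h` too, the next state has the law `P_(k)(· | s_h, a_h)`.
The forecast of the model of episode `k` and the policy `π^(k)` are determined by the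
information available before the first action of that episode. -/
structure Interaction {Ω : Type*} [m : MeasurableSpace Ω] (μ : Measure Ω) (env : ℕ → Model S A)
    (K H : ℕ) (s₀ : S) where
  ℱ : Filtration (ℕ ×ₗ ℕ) m
  state : ℕ → ℕ → Ω → S
  action : ℕ → ℕ → Ω → A
  forecast : ℕ → Ω → Model S A
  policy : ℕ → Ω → Policy S A
  state_zero : ∀ k ω, state k 0 ω = s₀
  measurable_state : ∀ k h s, MeasurableSet[ℱ (toLex (k, h))] {ω | state k h ω = s}
  measurable_action : ∀ k h a, MeasurableSet[ℱ (toLex (k, h + 1))] {ω | action k h ω = a}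
  measurable_forecast_P : ∀ k s a s',
    Measurable[ℱ (toLex (k, 0))] fun ω => (forecast k ω).P s a s'
  measurable_forecast_R : ∀ k s a, Measurable[ℱ (toLex (k, 0))] fun ω => (forecast k ω).R s a
  measurable_policy : ∀ k s a, Measurable[ℱ (toLex (k, 0))] fun ω => (policy k ω s).1 a
  isSubMDP_forecast : ∀ k ω, (forecast k ω).IsSubMDP
  law : ∀ k h, 1 ≤ k → k ≤ K → h < H → ∀ a s',
    μ[Set.indicator {ω | action k h ω = a ∧ state k (h + 1) ω = s'} (fun _ => (1 : ℝ)) |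
        ℱ (toLex (k, h))]
      =ᵐ[μ] fun ω => (policy k ω (state k h ω)).1 a * (env k).P (state k h ω) a s'

namespace Interaction

variable {Ω : Type*} [MeasurableSpace Ω] {μ : Measure Ω} {env : ℕ → Model S A}
  {K H : ℕ} {s₀ : S}

/-- Dynamic regret of the policies `π̂^(k+1)`, `1 ≤ k ≤ K - 1`. -/
def regret (X : Interaction μ env K H s₀) (γ : ℝ) (ω : Ω) : ℝ :=
  ∑ k ∈ Finset.Ico 1 K, ((env (k + 1)).optValue γ H s₀ -
    (env (k + 1)).value γ H (fun _ => X.policy (k + 1) ω) s₀)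

/-- `ι^K_H`: the discounted model prediction errors along the observed trajectories. -/
def iotaH (X : Interaction μ env K H s₀) (γ : ℝ) (ω : Ω) : ℝ :=
  ∑ k ∈ Finset.Ico 1 K, ∑ h ∈ Finset.range H, γ ^ h *
    modelError (env (k + 1)) (X.forecast (k + 1) ω) γ H (X.policy (k + 1) ω) h
      (X.state (k + 1) h ω) (X.action (k + 1) h ω)

/-- `ῑ^K_∞ = ∑_k ‖ῑ_∞^(k+1)‖_∞`. -/
def iotaInf (X : Interaction μ env K H s₀) (γ : ℝ) (ω : Ω) : ℝ :=
  ∑ k ∈ Finset.Ico 1 K, ‖optModelError (env (k + 1)) (X.forecast (k + 1) ω) γ‖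

/-- The maximum of `r_max` and `r̂_max`: the largest absolute value of a reward of the environment
and of the forecasted models, respectively, over the episodes `2, …, K`. -/
def rMax (X : Interaction μ env K H s₀) (ω : Ω) : ℝ :=
  max (⨆ k : Finset.Ico 1 K, ‖(env (k + 1)).R‖) (⨆ k : Finset.Ico 1 K, ‖(X.forecast (k + 1) ω).R‖)

/-- The largest, over the episodes, length of the shortest interval that contains `0` and all
forecasted rewards. -/
def rewardRange (X : Interaction μ env K H s₀) (ω : Ω) : ℝ :=
  ⨆ k : Finset.Ico 1 K, (‖(X.forecast (k + 1) ω).R⁺‖ + ‖(X.forecast (k + 1) ω).R⁻‖)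

/-- `C_p = 4 (r_max ∨ r̂_max) / (1 - γ) · √(H log (4 / p))`. -/
def Cp (X : Interaction μ env K H s₀) (γ p : ℝ) (ω : Ω) : ℝ :=
  4 * X.rMax ω / (1 - γ) * √(H * Real.log (4 / p))

/-- `𝕽_I = ῑ^K_∞ / (1 - γ) - ι^K_H + C_p √(K - 1)`. -/
def regretI (X : Interaction μ env K H s₀) (γ p : ℝ) (ω : Ω) : ℝ :=
  X.iotaInf γ ω / (1 - γ) - X.iotaH γ ω + X.Cp γ p ω * √((K : ℝ) - 1)

/-- `C_II[Δ]` for NPG without regularization, from the initial policies `init k`.  The term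
`‖log π₀‖_∞` is the largest value of `log (1 / π₀(a | s))`, which is `log |A|` if `π₀` is
uniform. -/
def CNPG (X : Interaction μ env K H s₀) (γ η : ℝ) (Δ : ℕ) (init : ℕ → Ω → Policy S A) (ω : Ω) :
    ℝ :=
  (X.rewardRange ω / (1 - γ) ^ 2 +
      (⨆ k : Finset.Ico 1 K, ‖fun s a => Real.log ((init k ω s).1 a)‖) / η) / Δ +
    4 * γ ^ H * X.rMax ω / (1 - γ)

/-- `C₁`: the initial error of entropy-regularized NPG, maximized over the episodes. -/
def C₁ (X : Interaction μ env K H s₀) (γ η τ : ℝ) (init : ℕ → Ω → Policy S A) (ω : Ω) : ℝ :=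
  ⨆ k : Finset.Ico 1 K,
    (‖(X.forecast (k + 1) ω).optSoftQ γ τ - (X.forecast (k + 1) ω).softQ γ τ (init k ω)‖ +
      2 * τ * (1 - η * τ / (1 - γ)) *
        ‖fun s a => Real.log ((X.forecast (k + 1) ω).optSoftPolicy γ τ s a) -
          Real.log ((init k ω s).1 a)‖)

/-- `C_II[Δ]` for entropy-regularized NPG, from the initial policies `init k`. -/
def CSoftNPG (X : Interaction μ env K H s₀) (γ η τ δ : ℝ) (Δ : ℕ) (init : ℕ → Ω → Policy S A)
    (ω : Ω) : ℝ :=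
  (γ + 2) * ((1 - η * τ) ^ (Δ - 1) * X.C₁ γ η τ init ω +
      2 * δ / (1 - γ) * (1 + γ / (η * τ))) +
    4 * γ ^ H * X.rMax ω / (1 - γ) + 2 * τ * Real.log (Fintype.card A) / (1 - γ)

end Interaction

end ProST

end

open ProST

namespace ProST

/-! The regret of one episode is a sum of four differences: the optimal true value minus the optimal
infinite-horizon value of the forecast; the suboptimality of the computed policy in the forecast;
the truncation error of its forecast value; and the error `V̂ - V` of its `H`-step value. The first
is bounded by induction on the horizon, paying `‖ῑ_∞‖` per step (`value_le_optValueInf_add`). The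
last telescopes along the observed trajectory into minus the observed model errors plus a martingale
(`sum_errorStep`, `avg_errorStep`).

The increments of this martingale are bounded only relative to the forecasted rewards, which are
random, so Azuma's inequality with deterministic bounds does not apply. The martingale is therefore
divided by the running maximum of the rewards, which is known when an episode starts. Since `cosh`
is even and increasing in the absolute value, a growing denominator can only lower `E cosh`, and
Hoeffding's lemma handles each step at a fixed denominator (`integral_cosh_totalNoise_le`). The
squared increment bounds of an episode add up to at most `8H/(1-γ)²` (`sum_sq_errorStep_bound_le`),
and Markov's inequality gives `C_p`.

For NPG, an update solved for `Q` bounds `Q` by a scaled increment of `log π` plus the next value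
(`npg_step`). Averaged under an optimal policy and summed over the iterations, this telescopes, and
monotone improvement passes to the last iterate (`npg_bound`). For regularized NPG, `τ log π + d`,
with `d` depending on the state only, is compared with both `Q_τ^*` and `Q_τ^π`. The two errors
together bound the suboptimality (`optSoftValue_le`), and their sum contracts by `1 - ητ` up to the
evaluation error (`soft_npg_step`).

Infinite-horizon comparisons rest on `maximum_principle`, which needs no visitation distributions
and tolerates kernels of mass below one. -/

lemma abs_apply_le_norm {S A : Type*} [Fintype S] [Fintype A] (f : S → A → ℝ) (s : S) (a : A) :
    |f s a| ≤ ‖f‖ :=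
  (norm_le_pi_norm (f s) a).trans (norm_le_pi_norm f s)

/-! ### Averages, entropy and Gibbs' inequality on the simplex. -/

section Simplex

variable {A : Type*} [Fintype A] (p : stdSimplex ℝ A)

lemma avg_mono {f g : A → ℝ} (h : ∀ a, f a ≤ g a) : ∑ a, p.1 a * f a ≤ ∑ a, p.1 a * g a :=
  Finset.sum_le_sum fun a _ => mul_le_mul_of_nonneg_left (h a) (p.2.1 a)

lemma avg_const (c : ℝ) : ∑ a, p.1 a * c = c := by
  rw [← Finset.sum_mul, p.2.2, one_mul]

lemma avg_add_const (f : A → ℝ) (c : ℝ) : ∑ a, p.1 a * (f a + c) = ∑ a, p.1 a * f a + c := by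
  simp only [mul_add, Finset.sum_add_distrib, avg_const]

lemma avg_le {f : A → ℝ} {c : ℝ} (h : ∀ a, f a ≤ c) : ∑ a, p.1 a * f a ≤ c :=
  (avg_mono p h).trans_eq (avg_const p c)

lemma le_avg {f : A → ℝ} {c : ℝ} (h : ∀ a, c ≤ f a) : c ≤ ∑ a, p.1 a * f a :=
  (avg_const p c).symm.trans_le (avg_mono p h)

lemma abs_avg_le {f : A → ℝ} {c : ℝ} (h : ∀ a, |f a| ≤ c) : |∑ a, p.1 a * f a| ≤ c :=
  abs_le.2 ⟨le_avg p fun a => (abs_le.1 (h a)).1, avg_le p fun a => (abs_le.1 (h a)).2⟩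

lemma simplex_le_one (a : A) : p.1 a ≤ 1 := (mem_Icc_of_mem_stdSimplex p.2 a).2

/-- Gibbs' inequality. -/
lemma gibbs {σ : A → ℝ} (hσ : ∀ a, 0 < σ a) (hσ₁ : ∑ a, σ a ≤ 1) :
    ∑ a, p.1 a * (Real.log (σ a) - Real.log (p.1 a)) ≤ 0 := by
  have key : ∀ a, p.1 a * (Real.log (σ a) - Real.log (p.1 a)) ≤ σ a - p.1 a := by
    intro a
    rcases (p.2.1 a).eq_or_lt with h | h
    · rw [← h]; simpa using (hσ a).le
    · rw [← Real.log_div (hσ a).ne' h.ne']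
      have := mul_le_mul_of_nonneg_left (Real.log_le_sub_one_of_pos (div_pos (hσ a) h)) h.le
      refine this.trans_eq ?_
      field_simp
  calc _ ≤ ∑ a, (σ a - p.1 a) := Finset.sum_le_sum fun a _ => key a
    _ ≤ 0 := by rw [Finset.sum_sub_distrib, p.2.2]; linarith

/-- Gibbs' inequality against the uniform distribution. -/
lemma neg_avg_log_le : ∑ a, p.1 a * -Real.log (p.1 a) ≤ Real.log (Fintype.card A) := by
  have hA : Nonempty A := by
    by_contra h
    rw [not_nonempty_iff] at h
    simpa using p.2.2
  have hc : (0 : ℝ) < Fintype.card A := by exact_mod_cast Fintype.card_pos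
  have := gibbs p (σ := fun _ => (Fintype.card A : ℝ)⁻¹) (fun _ => inv_pos.2 hc)
    (by simp [hc.ne'])
  simp only [Real.log_inv, sub_eq_add_neg] at this
  have h2 : ∑ a, p.1 a * (-Real.log (p.1 a) + -Real.log (Fintype.card A : ℝ)) ≤ 0 := by
    simpa [add_comm] using this
  rw [avg_add_const] at h2
  linarith

/-- The entropy-regularized average `E_p[q] + τ · entropy(p)`. -/
noncomputable def regAvg (τ : ℝ) (p : stdSimplex ℝ A) (q : A → ℝ) : ℝ :=
  ∑ a, p.1 a * (q a - τ * Real.log (p.1 a))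

lemma regAvg_le_add {τ : ℝ} {q q' : A → ℝ} {c : ℝ} (h : ∀ a, q a ≤ q' a + c) :
    regAvg τ p q ≤ regAvg τ p q' + c := by
  rw [regAvg, regAvg, ← avg_add_const]
  exact avg_mono p fun a => by linarith [h a]

lemma regAvg_zero (q : A → ℝ) : regAvg 0 p q = ∑ a, p.1 a * q a := by simp [regAvg]

/-- Compactness of the simplex. The logarithm is discontinuous at `0`, but `negMulLog` is
continuous, so the objective is too, for every real `τ`. -/
lemma exists_regAvg_max [Nonempty A] (τ : ℝ) (q : A → ℝ) :
    ∃ p : stdSimplex ℝ A, ∀ p', regAvg τ p' q ≤ regAvg τ p q := by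
  classical
  have hc : Continuous fun x : A → ℝ => ∑ a, x a * (q a - τ * Real.log (x a)) := by
    have : ∀ x : A → ℝ, ∑ a, x a * (q a - τ * Real.log (x a)) =
        ∑ a, (x a * q a + τ * Real.negMulLog (x a)) := fun x =>
      Finset.sum_congr rfl fun a _ => by simp only [Real.negMulLog]; ring
    simp only [this]
    have := Real.continuous_negMulLog
    fun_prop
  obtain ⟨x, hx, hmax⟩ := (isCompact_stdSimplex ℝ A).exists_isMaxOn
    ⟨_, single_mem_stdSimplex ℝ (Classical.arbitrary A)⟩ hc.continuousOn
  exact ⟨⟨x, hx⟩, fun p' => hmax p'.2⟩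

end Simplex

/-- Applying the hypothesis at a state where `U` is maximal gives `max U ≤ c + γ max U`. Only
nonnegative `B` occur in the hypothesis because a kernel of mass below one does not preserve
negative upper bounds. -/
lemma maximum_principle {S : Type*} [Finite S] {γ c : ℝ} (hγ₁ : γ < 1) (hc : 0 ≤ c)
    (U : S → ℝ) (h : ∀ B, 0 ≤ B → (∀ s, U s ≤ B) → ∀ s, U s ≤ c + γ * B) (s : S) :
    U s ≤ c / (1 - γ) := by
  have : Nonempty S := ⟨s⟩
  obtain ⟨x, hx⟩ := Finite.exists_max U
  -- A negative maximum is replaced by `0`; then the claim is trivial, as `c ≥ 0`.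
  have h1 := h (max (U x) 0) (le_max_right _ _) (fun s => (hx s).trans (le_max_left _ _)) x
  refine (hx s).trans ?_
  rw [le_div_iff₀ (by linarith)]
  rcases le_total (U x) 0 with h0 | h0
  · nlinarith
  · rw [max_eq_left h0] at h1; nlinarith

/-! ### Bellman equations, with and without regularization. -/

namespace Model

variable {S A : Type*} [Fintype S] {M : Model S A}

lemma IsMDP.isSubMDP (h : M.IsMDP) : M.IsSubMDP := ⟨h.1, fun s a => (h.2 s a).le⟩

lemma next_add (V W : S → ℝ) (s : S) (a : A) :
    M.next (fun x => V x + W x) s a = M.next V s a + M.next W s a := by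
  simp only [next, mul_add, Finset.sum_add_distrib]

lemma next_sub (V W : S → ℝ) (s : S) (a : A) :
    M.next (fun x => V x - W x) s a = M.next V s a - M.next W s a := by
  simp only [next, mul_sub, Finset.sum_sub_distrib]

lemma next_mul_left (c : ℝ) (V : S → ℝ) (s : S) (a : A) :
    M.next (fun x => c * V x) s a = c * M.next V s a := by
  simp only [next, Finset.mul_sum]
  exact Finset.sum_congr rfl fun _ _ => by ring

lemma next_sum {ι : Type*} (t : Finset ι) (V : ι → S → ℝ) (s : S) (a : A) :
    M.next (fun x => ∑ i ∈ t, V i x) s a = ∑ i ∈ t, M.next (V i) s a := by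
  simp only [next, Finset.mul_sum]
  exact Finset.sum_comm

lemma IsSubMDP.next_mono (hM : M.IsSubMDP) {V W : S → ℝ} (h : ∀ s, V s ≤ W s) (s : S) (a : A) :
    M.next V s a ≤ M.next W s a :=
  Finset.sum_le_sum fun s' _ => mul_le_mul_of_nonneg_left (h s') (hM.1 s a s')

lemma IsSubMDP.next_le (hM : M.IsSubMDP) {V : S → ℝ} {c : ℝ} (hc : 0 ≤ c) (h : ∀ s, V s ≤ c)
    (s : S) (a : A) : M.next V s a ≤ c := by
  refine (hM.next_mono h s a).trans ?_
  rw [next, ← Finset.sum_mul]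
  exact mul_le_of_le_one_left hc (hM.2 s a)

lemma IsSubMDP.next_le_add (hM : M.IsSubMDP) {V W : S → ℝ} {c : ℝ} (hc : 0 ≤ c)
    (h : ∀ s, V s ≤ W s + c) (s : S) (a : A) : M.next V s a ≤ M.next W s a + c := by
  have := hM.next_le hc (V := fun x => V x - W x) (fun s => by linarith [h s]) s a
  rw [next_sub] at this
  linarith

lemma IsSubMDP.abs_next_le (hM : M.IsSubMDP) {V : S → ℝ} {c : ℝ} (h : ∀ s, |V s| ≤ c)
    (s : S) (a : A) : |M.next V s a| ≤ c := by
  have hc : 0 ≤ c := (abs_nonneg _).trans (h s)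
  refine abs_le.2 ⟨?_, hM.next_le hc (fun s => (abs_le.1 (h s)).2) s a⟩
  have := hM.next_le_add hc (V := fun _ => 0) (W := V) (fun s => by linarith [(abs_le.1 (h s)).1])
    s a
  simp only [next, mul_zero, Finset.sum_const_zero] at this ⊢
  linarith

lemma IsSubMDP.backup_le_add (hM : M.IsSubMDP) {γ : ℝ} (hγ₀ : 0 ≤ γ) {V W : S → ℝ} {c : ℝ}
    (hc : 0 ≤ c) (h : ∀ s, V s ≤ W s + c) (s : S) (a : A) :
    M.backup γ V s a ≤ M.backup γ W s a + γ * c := by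
  have := mul_le_mul_of_nonneg_left (hM.next_le_add hc h s a) hγ₀
  simp only [backup]
  linarith

/-- A nonexpansive Bellman operator has a fixed point. -/
lemma IsSubMDP.exists_fixed_point (hM : M.IsSubMDP) {γ : ℝ} (hγ₀ : 0 ≤ γ) (hγ₁ : γ < 1)
    (F : (A → ℝ) → ℝ) (hF : ∀ q q' c, (∀ a, q a ≤ q' a + c) → F q ≤ F q' + c) :
    ∃ W : S → ℝ, ∀ s, W s = F (M.backup γ W s) := by
  have hT : ∀ V W : S → ℝ, ∀ s, F (M.backup γ V s) ≤ F (M.backup γ W s) + γ * dist V W := by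
    intro V W s
    refine hF _ _ _ fun a => hM.backup_le_add hγ₀ dist_nonneg (fun s => ?_) s a
    have := (abs_le.1 ((Real.dist_eq _ _).symm.trans_le (dist_le_pi_dist V W s))).2
    linarith
  have hc : ContractingWith ⟨γ, hγ₀⟩ fun (V : S → ℝ) s => F (M.backup γ V s) := by
    refine ⟨by exact_mod_cast hγ₁, LipschitzWith.of_dist_le_mul fun V W => ?_⟩
    refine (dist_pi_le_iff (by positivity)).2 fun s => ?_
    change _ ≤ γ * _
    rw [Real.dist_eq, abs_le]
    have h1 := hT V W s
    have h2 := hT W V s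
    rw [dist_comm W V] at h2
    constructor <;> linarith
  exact ⟨hc.fixedPoint _, fun s => (congrFun hc.fixedPoint_isFixedPt s).symm⟩

variable [Fintype A]

lemma IsSubMDP.abs_expect_le (hM : M.IsSubMDP) {f : S → A → ℝ} {B : ℝ} (hf : ∀ s a, |f s a| ≤ B)
    (h : ℕ) (π : ℕ → Policy S A) (s : S) : |M.expect f h π s| ≤ B := by
  induction h generalizing π s with
  | zero => exact abs_avg_le _ fun a => hf s a
  | succ h ih => exact abs_avg_le _ fun a => hM.abs_next_le (fun s => ih _ s) s a

lemma value_zero (γ : ℝ) (π : ℕ → Policy S A) (s : S) : M.value γ 0 π s = 0 := by simp [value]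

lemma value_succ (γ : ℝ) (n : ℕ) (π : ℕ → Policy S A) (s : S) :
    M.value γ (n + 1) π s =
      ∑ a, (π 0 s).1 a * M.backup γ (M.value γ n fun i => π (i + 1)) s a := by
  have hn : ∀ a, M.next (M.value γ n fun i => π (i + 1)) s a =
      ∑ h ∈ Finset.range n, γ ^ h * M.next (M.expect M.R h fun i => π (i + 1)) s a := by
    intro a
    have : (M.value γ n fun i => π (i + 1)) =
        fun x => ∑ h ∈ Finset.range n, γ ^ h * M.expect M.R h (fun i => π (i + 1)) x := rfl
    rw [this, next_sum]
    simp only [next_mul_left]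
  rw [value, Finset.sum_range_succ']
  simp only [expect, backup, hn, pow_zero, one_mul, mul_add, Finset.sum_add_distrib,
    Finset.mul_sum]
  rw [add_comm, Finset.sum_comm]
  congr 1
  refine Finset.sum_congr rfl fun a _ => Finset.sum_congr rfl fun h _ => ?_
  ring

lemma IsSubMDP.abs_value_le (hM : M.IsSubMDP) {γ r : ℝ} (hγ₀ : 0 ≤ γ)
    (hr : ∀ s a, |M.R s a| ≤ r) (n : ℕ) (π : ℕ → Policy S A) (s : S) :
    |M.value γ n π s| ≤ r * ∑ i ∈ Finset.range n, γ ^ i := by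
  rw [value, Finset.mul_sum]
  refine (Finset.abs_sum_le_sum_abs _ _).trans (Finset.sum_le_sum fun i _ => ?_)
  rw [abs_mul, abs_of_nonneg (pow_nonneg hγ₀ i), mul_comm]
  exact mul_le_mul_of_nonneg_right (hM.abs_expect_le hr i π s) (pow_nonneg hγ₀ i)

/-- Infinite-horizon discounted expectation of `f` under a stationary policy. -/
noncomputable def discounted (M : Model S A) (γ : ℝ) (f : S → A → ℝ) (π : Policy S A) (s : S) : ℝ :=
  ∑' h : ℕ, γ ^ h * M.expect f h (fun _ => π) s

lemma IsSubMDP.discounted_eq (hM : M.IsSubMDP) {γ : ℝ} (hγ₀ : 0 ≤ γ) (hγ₁ : γ < 1)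
    (f : S → A → ℝ) (π : Policy S A) (s : S) :
    M.discounted γ f π s = ∑ a, (π s).1 a * (f s a + γ * M.next (M.discounted γ f π) s a) := by
  have hs : ∀ s, Summable fun h : ℕ => γ ^ h * M.expect f h (fun _ => π) s := by
    intro s
    refine Summable.of_norm_bounded ((summable_geometric_of_lt_one hγ₀ hγ₁).mul_right ‖f‖)
      fun h => ?_
    rw [norm_mul, Real.norm_of_nonneg (pow_nonneg hγ₀ h)]
    exact mul_le_mul_of_nonneg_left (hM.abs_expect_le (abs_apply_le_norm f) h _ s)
      (pow_nonneg hγ₀ h)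
  have h2 : HasSum (fun h : ℕ => γ ^ (h + 1) * M.expect f (h + 1) (fun _ => π) s)
      (∑ a, (π s).1 a * (γ * M.next (M.discounted γ f π) s a)) := by
    have : ∀ h : ℕ, γ ^ (h + 1) * M.expect f (h + 1) (fun _ => π) s =
        ∑ a, (π s).1 a * (γ * ∑ s', M.P s a s' * (γ ^ h * M.expect f h (fun _ => π) s')) := by
      intro h
      simp only [expect, next, Finset.mul_sum]
      refine Finset.sum_congr rfl fun a _ => Finset.sum_congr rfl fun s' _ => ?_
      ring
    simp only [this]
    exact hasSum_sum fun a _ => ((hasSum_sum fun s' _ => (hs s').hasSum.mul_left _).mul_left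
      _).mul_left _
  rw [discounted, (hs s).tsum_eq_zero_add, h2.tsum_eq]
  simp only [expect, pow_zero, one_mul, mul_add, Finset.sum_add_distrib]

/-- The bound is asked of averages of `f` only: `-log π(a|s)` may exceed `log |A|`, while its
average under `π` may not. -/
lemma IsSubMDP.discounted_le (hM : M.IsSubMDP) {γ : ℝ} (hγ₀ : 0 ≤ γ) (hγ₁ : γ < 1)
    {f : S → A → ℝ} {π : Policy S A} {c : ℝ} (hc : 0 ≤ c)
    (hf : ∀ s, ∑ a, (π s).1 a * f s a ≤ c) (s : S) : M.discounted γ f π s ≤ c / (1 - γ) := by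
  refine maximum_principle hγ₁ hc _ (fun B hB h s => ?_) s
  rw [hM.discounted_eq hγ₀ hγ₁]
  simp only [mul_add, Finset.sum_add_distrib]
  exact add_le_add (hf s) (avg_le _ fun a => mul_le_mul_of_nonneg_left (hM.next_le hB h s a) hγ₀)

lemma discounted_neg (γ : ℝ) (f : S → A → ℝ) (π : Policy S A) (s : S) :
    M.discounted γ (fun s a => -f s a) π s = -M.discounted γ f π s := by
  have : ∀ (h : ℕ) (π : ℕ → Policy S A) (s : S),
      M.expect (fun s a => -f s a) h π s = -M.expect f h π s := by
    intro h
    induction h with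
    | zero => intro π s; simp [expect]
    | succ h ih => intro π s; simp [expect, ih, next]
  simp [discounted, this, tsum_neg]

lemma IsSubMDP.le_discounted (hM : M.IsSubMDP) {γ : ℝ} (hγ₀ : 0 ≤ γ) (hγ₁ : γ < 1)
    {f : S → A → ℝ} {π : Policy S A} {c : ℝ} (hc : 0 ≤ c)
    (hf : ∀ s, -c ≤ ∑ a, (π s).1 a * f s a) (s : S) : -(c / (1 - γ)) ≤ M.discounted γ f π s := by
  have := hM.discounted_le hγ₀ hγ₁ (f := fun s a => -f s a) (π := π) hc
    (fun s => by simp only [mul_neg, Finset.sum_neg_distrib]; linarith [hf s]) s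
  rw [discounted_neg] at this
  linarith

lemma valueInf_eq_discounted (γ : ℝ) (π : Policy S A) (s : S) :
    M.valueInf γ π s = M.discounted γ M.R π s := rfl

lemma entropy_eq_discounted (γ : ℝ) (π : Policy S A) (s : S) :
    M.entropy γ π s = M.discounted γ (fun s a => -Real.log ((π s).1 a)) π s := rfl

lemma IsSubMDP.abs_valueInf_le (hM : M.IsSubMDP) {γ r : ℝ} (hγ₀ : 0 ≤ γ) (hγ₁ : γ < 1)
    (hr₀ : 0 ≤ r) (hr : ∀ s a, |M.R s a| ≤ r) (π : Policy S A) (s : S) :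
    |M.valueInf γ π s| ≤ r / (1 - γ) :=
  abs_le.2 ⟨hM.le_discounted hγ₀ hγ₁ hr₀ (fun s => le_avg _ fun a => (abs_le.1 (hr s a)).1) s,
    hM.discounted_le hγ₀ hγ₁ hr₀ (fun s => avg_le _ fun a => (abs_le.1 (hr s a)).2) s⟩

lemma IsSubMDP.entropy_nonneg (hM : M.IsSubMDP) {γ : ℝ} (hγ₀ : 0 ≤ γ) (hγ₁ : γ < 1)
    (π : Policy S A) (s : S) : 0 ≤ M.entropy γ π s := by
  have := hM.le_discounted hγ₀ hγ₁ (f := fun s a => -Real.log ((π s).1 a)) (π := π) le_rfl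
    (fun s => by
      rw [neg_zero]
      exact le_avg _ fun a => neg_nonneg.2 (Real.log_nonpos ((π s).2.1 a) (simplex_le_one _ a))) s
  simpa [entropy_eq_discounted] using this

lemma IsSubMDP.entropy_le (hM : M.IsSubMDP) {γ : ℝ} (hγ₀ : 0 ≤ γ) (hγ₁ : γ < 1)
    (π : Policy S A) (s : S) : M.entropy γ π s ≤ Real.log (Fintype.card A) / (1 - γ) :=
  hM.discounted_le hγ₀ hγ₁ (Real.log_natCast_nonneg _) (fun s => neg_avg_log_le (π s)) s

lemma softValue_zero (γ : ℝ) : M.softValue γ 0 = M.valueInf γ := by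
  funext π s; simp [softValue]

lemma softQ_zero (γ : ℝ) : M.softQ γ 0 = M.qInf γ := by
  funext π; simp [softQ, qInf, softValue_zero]

lemma optSoftValue_zero (γ : ℝ) : M.optSoftValue γ 0 = M.optValueInf γ := by
  funext s; simp [optSoftValue, optValueInf, softValue_zero]

lemma optSoftQ_zero (γ : ℝ) : M.optSoftQ γ 0 = M.optQInf γ := by
  simp [optSoftQ, optQInf, optSoftValue_zero]

/-- Bellman equation of the entropy-regularized value. -/
lemma IsSubMDP.softValue_eq (hM : M.IsSubMDP) {γ : ℝ} (hγ₀ : 0 ≤ γ) (hγ₁ : γ < 1) (τ : ℝ)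
    (π : Policy S A) (s : S) :
    M.softValue γ τ π s = regAvg τ (π s) (M.softQ γ τ π s) := by
  have hn : ∀ a, M.next (M.softValue γ τ π) s a = M.next (M.valueInf γ π) s a +
      τ * M.next (M.entropy γ π) s a := by
    intro a
    rw [← next_mul_left, ← next_add]
    rfl
  have h1 := hM.discounted_eq hγ₀ hγ₁ M.R π s
  have h2 := hM.discounted_eq hγ₀ hγ₁ (fun s a => -Real.log ((π s).1 a)) π s
  rw [softValue, valueInf_eq_discounted, entropy_eq_discounted, h1, h2, regAvg, Finset.mul_sum,
    ← Finset.sum_add_distrib]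
  refine Finset.sum_congr rfl fun a _ => ?_
  simp only [softQ, backup, hn]
  change (π s).1 a * (_ + γ * M.next (M.valueInf γ π) s a) + τ * ((π s).1 a *
    (_ + γ * M.next (M.entropy γ π) s a)) = _
  ring

lemma IsSubMDP.valueInf_eq (hM : M.IsSubMDP) {γ : ℝ} (hγ₀ : 0 ≤ γ) (hγ₁ : γ < 1)
    (π : Policy S A) (s : S) :
    M.valueInf γ π s = ∑ a, (π s).1 a * M.qInf γ π s a := by
  rw [← softValue_zero, hM.softValue_eq hγ₀ hγ₁, regAvg_zero, softQ_zero]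

/-- Bellman optimality for the (regularized) infinite-horizon problem. -/
lemma IsSubMDP.bellman_optimality [Nonempty A] (hM : M.IsSubMDP) {γ : ℝ} (hγ₀ : 0 ≤ γ)
    (hγ₁ : γ < 1) (τ : ℝ) :
    (∀ π s, M.softValue γ τ π s ≤ M.optSoftValue γ τ s) ∧
    (∀ p s, regAvg τ p (M.optSoftQ γ τ s) ≤ M.optSoftValue γ τ s) ∧
    ∃ π : Policy S A, M.softValue γ τ π = M.optSoftValue γ τ ∧
      ∀ s, M.optSoftValue γ τ s = regAvg τ (π s) (M.optSoftQ γ τ s) := by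
  choose greedy hg using fun q : A → ℝ => exists_regAvg_max τ q
  -- `W` solves the optimality equation. It dominates every value, and the policy greedy for `W`
  -- attains it, both by the maximum principle. The case `τ = 0` is the unregularized problem.
  obtain ⟨W, hW⟩ := hM.exists_fixed_point hγ₀ hγ₁ (fun q => regAvg τ (greedy q) q)
    fun q q' c h => (regAvg_le_add _ h).trans (by linarith [hg q' (greedy q)])
  have hle : ∀ π s, M.softValue γ τ π s ≤ W s := by
    intro π s
    have := maximum_principle hγ₁ le_rfl (fun s => M.softValue γ τ π s - W s)
      (fun B hB h s => ?_) s
    · simp only [zero_div] at this; linarith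
    · have h1 := regAvg_le_add (π s) (τ := τ) (hM.backup_le_add hγ₀ hB (V := M.softValue γ τ π)
        (W := W) (fun s => by linarith [h s]) s)
      have h2 := hM.softValue_eq hγ₀ hγ₁ τ π s
      have h3 := hg (M.backup γ W s) (π s)
      have h4 := hW s
      change _ = regAvg τ (π s) (M.backup γ (M.softValue γ τ π) s) at h2
      linarith
  let π : Policy S A := fun s => greedy (M.backup γ W s)
  have hge : ∀ s, W s ≤ M.softValue γ τ π s := by
    intro s
    have := maximum_principle hγ₁ le_rfl (fun s => W s - M.softValue γ τ π s)
      (fun B hB h s => ?_) s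
    · simp only [zero_div] at this; linarith
    · have h1 := regAvg_le_add (π s) (τ := τ) (hM.backup_le_add hγ₀ hB (V := W)
        (W := M.softValue γ τ π) (fun s => by linarith [h s]) s)
      have h2 := hM.softValue_eq hγ₀ hγ₁ τ π s
      have h4 := hW s
      change _ = regAvg τ (π s) (M.backup γ (M.softValue γ τ π) s) at h2
      linarith
  have hπ : M.softValue γ τ π = W := funext fun s => (hle π s).antisymm (hge s)
  have hopt : M.optSoftValue γ τ = W := by
    funext s
    have : Nonempty (Policy S A) := ⟨π⟩
    exact le_antisymm (ciSup_le fun π => hle π s)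
      ((hge s).trans (le_ciSup ⟨W s, by rintro _ ⟨π, rfl⟩; exact hle π s⟩ π))
  have hQ : M.optSoftQ γ τ = M.backup γ W := by rw [← hopt]; rfl
  rw [hopt, hQ]
  exact ⟨hle, fun p s => (hg _ p).trans_eq (hW s).symm, π, hπ, hW⟩

end Model

end ProST

/-! ### Convergence of natural policy gradient. -/

namespace ProST

variable {S A : Type*} [Fintype A]

/-- In logarithms the update is affine, and the normalization is a constant `c s` that does not
depend on the action. -/
lemma IsNPGStep.log_eq {γ η τ : ℝ} {π π' : Policy S A} {Q : S → A → ℝ}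
    (h : IsNPGStep γ η τ π Q π') (hπ : ∀ s a, 0 < (π s).1 a) :
    (∀ s a, 0 < (π' s).1 a) ∧ ∃ c : S → ℝ, ∀ s a, Real.log ((π' s).1 a) =
      (1 - η * τ / (1 - γ)) * Real.log ((π s).1 a) + η * Q s a / (1 - γ) - c s := by
  have hw : ∀ s a, 0 < (π s).1 a ^ (1 - η * τ / (1 - γ)) * Real.exp (η * Q s a / (1 - γ)) :=
    fun s a => mul_pos (Real.rpow_pos_of_pos (hπ s a) _) (Real.exp_pos _)
  have hZ : ∀ (s : S) (_ : A), 0 < ∑ b, (π s).1 b ^ (1 - η * τ / (1 - γ)) *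
      Real.exp (η * Q s b / (1 - γ)) :=
    fun s a => Finset.sum_pos (fun b _ => hw s b) ⟨a, Finset.mem_univ a⟩
  refine ⟨fun s a => by rw [h s a]; exact div_pos (hw s a) (hZ s a),
    fun s => Real.log (∑ b, (π s).1 b ^ (1 - η * τ / (1 - γ)) * Real.exp (η * Q s b / (1 - γ))),
    fun s a => ?_⟩
  rw [h s a, Real.log_div (hw s a).ne' (hZ s a).ne',
    Real.log_mul (Real.rpow_pos_of_pos (hπ s a) _).ne' (Real.exp_pos _).ne', Real.log_exp,
    Real.log_rpow (hπ s a)]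

lemma gibbs_policy {π π' : Policy S A} (hπ' : ∀ s a, 0 < (π' s).1 a) (s : S) :
    ∑ a, (π s).1 a * (Real.log ((π' s).1 a) - Real.log ((π s).1 a)) ≤ 0 :=
  gibbs (π s) (hπ' s) (π' s).2.2.le

namespace Model

variable [Fintype S] {M : Model S A}

/-- If one step of `π'` followed by `π` loses at most `e`, then following `π'` forever loses at most
the geometric series of `e`. -/
lemma IsSubMDP.policy_improvement (hM : M.IsSubMDP) {γ : ℝ} (hγ₀ : 0 ≤ γ) (hγ₁ : γ < 1)
    {τ e : ℝ} (he : 0 ≤ e) {π π' : Policy S A}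
    (h : ∀ s, M.softValue γ τ π s ≤ regAvg τ (π' s) (M.softQ γ τ π s) + e) (s : S) :
    M.softValue γ τ π s ≤ M.softValue γ τ π' s + e / (1 - γ) := by
  have := maximum_principle hγ₁ he (fun s => M.softValue γ τ π s - M.softValue γ τ π' s)
    (fun B hB hU s => ?_) s
  · linarith
  · have h1 := regAvg_le_add (π' s) (τ := τ) (hM.backup_le_add hγ₀ hB (V := M.softValue γ τ π)
      (W := M.softValue γ τ π') (fun s => by linarith [hU s]) s)
    have h2 := hM.softValue_eq hγ₀ hγ₁ τ π' s
    have h3 := h s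
    simp only [softQ] at h2 h3
    linarith

/-- Solving the update for `Q` gives a multiple of `log π' - log π` plus a function of the state.
Two uses of Gibbs' inequality place that function between the average of `Q` under `π`, which is
`V^π`, and its average under `π'`, which is at most `V^{π'}`. -/
lemma IsSubMDP.npg_step (hM : M.IsSubMDP) {γ η : ℝ} (hγ₀ : 0 ≤ γ) (hγ₁ : γ < 1) (hη : 0 < η)
    {π π' : Policy S A} (h : IsNPGStep γ η 0 π (M.qInf γ π) π') (hπ : ∀ s a, 0 < (π s).1 a) :
    (∀ s a, 0 < (π' s).1 a) ∧ (∀ s, M.valueInf γ π s ≤ M.valueInf γ π' s) ∧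
    ∀ s a, M.qInf γ π s a ≤ (1 - γ) / η * (Real.log ((π' s).1 a) - Real.log ((π s).1 a)) +
      M.valueInf γ π' s := by
  obtain ⟨hπ', c, hc⟩ := h.log_eq hπ
  have hβ : 0 < (1 - γ) / η := div_pos (by linarith) hη
  have hγ' : 1 - γ ≠ 0 := by linarith
  have hQ : ∀ s a, M.qInf γ π s a = (1 - γ) / η * (Real.log ((π' s).1 a) -
      Real.log ((π s).1 a)) + (1 - γ) / η * c s := by
    intro s a
    rw [hc s a]
    field_simp
    ring
  have h1 : ∀ s, M.valueInf γ π s ≤ (1 - γ) / η * c s := by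
    intro s
    have := gibbs_policy (π := π) hπ' s
    rw [hM.valueInf_eq hγ₀ hγ₁]
    simp only [hQ, avg_add_const, mul_left_comm _ ((1 - γ) / η), ← Finset.mul_sum]
    nlinarith
  have h2 : ∀ s, (1 - γ) / η * c s ≤ ∑ a, (π' s).1 a * M.qInf γ π s a := by
    intro s
    have := gibbs_policy (π := π') hπ s
    have h' : ∑ a, (π' s).1 a * (Real.log ((π' s).1 a) - Real.log ((π s).1 a)) =
        -∑ a, (π' s).1 a * (Real.log ((π s).1 a) - Real.log ((π' s).1 a)) := by
      rw [← Finset.sum_neg_distrib]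
      exact Finset.sum_congr rfl fun a _ => by ring
    simp only [hQ, avg_add_const, mul_left_comm _ ((1 - γ) / η), ← Finset.mul_sum, h']
    nlinarith
  have h3 : ∀ s, M.valueInf γ π s ≤ M.valueInf γ π' s := by
    intro s
    have := hM.policy_improvement hγ₀ hγ₁ (τ := 0) le_rfl (π := π) (π' := π') (fun s => by
      rw [softValue_zero, softQ_zero, regAvg_zero]; linarith [h1 s, h2 s]) s
    simpa [softValue_zero] using this
  refine ⟨hπ', h3, fun s a => ?_⟩
  rw [hQ s a]
  have h4 : (1 - γ) / η * c s ≤ M.valueInf γ π' s := by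
    rw [hM.valueInf_eq hγ₀ hγ₁]
    refine (h2 s).trans (avg_mono _ fun a => ?_)
    have := hM.backup_le_add hγ₀ le_rfl (V := M.valueInf γ π) (W := M.valueInf γ π')
      (fun s => by linarith [h3 s]) s a
    simpa [qInf] using this
  linarith

/-- Convergence of natural policy gradient with exact values. -/
theorem IsSubMDP.npg_bound [Nonempty A] (hM : M.IsSubMDP) {γ η : ℝ} (hγ₀ : 0 ≤ γ) (hγ₁ : γ < 1)
    (hη : 0 < η) {n : ℕ} (hn : 1 ≤ n) {π₀ π : Policy S A} (hπ₀ : ∀ s a, 0 < (π₀ s).1 a)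
    (h : IsNPG M γ η n π₀ π) (s : S) :
    M.optValueInf γ s - M.valueInf γ π s ≤ ((‖M.R⁺‖ + ‖M.R⁻‖) / (1 - γ) ^ 2 +
      ‖fun s a => Real.log ((π₀ s).1 a)‖ / η) / n := by
  obtain ⟨it, rfl, rfl, hit⟩ := h
  have hγ' : 0 < 1 - γ := by linarith
  have hpos : ∀ g ≤ n, ∀ s a, 0 < (it g s).1 a := by
    intro g
    induction g with
    | zero => exact fun _ => hπ₀
    | succ g ih => exact fun hg => (hM.npg_step hγ₀ hγ₁ hη (hit g hg) (ih (by lia))).1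
  have hstep := fun g (hg : g < n) => hM.npg_step hγ₀ hγ₁ hη (hit g hg) (hpos g hg.le)
  have hmono : ∀ g ≤ n, ∀ s, M.valueInf γ (it g) s ≤ M.valueInf γ (it n) s := by
    intro g hg s
    induction hg using Nat.decreasingInduction with
    | self => exact le_rfl
    | of_succ g hg ih => exact ((hstep g hg).2.1 s).trans ih
  obtain ⟨-, -, πs, hπs, hopt⟩ := hM.bellman_optimality hγ₀ hγ₁ 0
  simp only [optSoftValue_zero, optSoftQ_zero, softValue_zero, regAvg_zero] at hπs hopt
  set L := ‖fun s a => Real.log ((it 0 s).1 a)‖ with hL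
  set ρ := ‖M.R⁺‖ + ‖M.R⁻‖ with hρ
  have hL₀ : 0 ≤ L := norm_nonneg _
  have hρ₀ : 0 ≤ ρ := by positivity
  have hV : ∀ s, M.valueInf γ (it n) s - M.valueInf γ (it 0) s ≤ ρ / (1 - γ) := by
    intro s
    have h1 := hM.discounted_le hγ₀ hγ₁ (f := M.R) (π := it n) (norm_nonneg M.R⁺) (fun s =>
      avg_le _ fun a => (le_posPart (M.R s a)).trans
        ((le_abs_self _).trans (abs_apply_le_norm M.R⁺ s a))) s
    have h2 := hM.le_discounted hγ₀ hγ₁ (f := M.R) (π := it 0) (norm_nonneg M.R⁻) (fun s =>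
      le_avg _ fun a => by
        have h3 : -M.R s a ≤ (M.R s a)⁻ := neg_le_negPart (M.R s a)
        have h4 := (le_abs_self _).trans (abs_apply_le_norm M.R⁻ s a)
        have h5 : M.R⁻ s a = (M.R s a)⁻ := rfl
        linarith) s
    rw [valueInf_eq_discounted, valueInf_eq_discounted, hρ, add_div]
    linarith
  -- The principle is applied to the sum over all iterations, since only the sum telescopes.
  -- Division by `1 - γ` turns the constant into `L/η + ρ/(1-γ)²`.
  have hD := maximum_principle hγ₁ (c := (1 - γ) / η * L + ρ / (1 - γ)) (by positivity)
    (fun s => ∑ g ∈ Finset.range n, (M.optValueInf γ s - M.valueInf γ (it g) s))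
    (fun B hB hU s => ?_) s
  · have h1 : (n : ℝ) * (M.optValueInf γ s - M.valueInf γ (it n) s) ≤
        ∑ g ∈ Finset.range n, (M.optValueInf γ s - M.valueInf γ (it g) s) := by
      rw [← nsmul_eq_mul]
      have := Finset.card_nsmul_le_sum (Finset.range n)
        (fun g => M.optValueInf γ s - M.valueInf γ (it g) s)
        (M.optValueInf γ s - M.valueInf γ (it n) s)
        (fun g hg => by linarith [hmono g (Finset.mem_range.1 hg).le s])
      simpa using this
    have hn' : (0 : ℝ) < n := by exact_mod_cast hn
    rw [le_div_iff₀ hn', mul_comm]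
    refine (h1.trans hD).trans_eq ?_
    field_simp
    ring
  -- Split `Q^*` into `Q^* - Q^g`, which is `γ P (V^* - V^g)`, and `Q^g`, to which `npg_step`
  -- applies. Besides the discounted term, only differences of consecutive iterates remain.
  · have h1 : ∀ g ∈ Finset.range n, M.optValueInf γ s - M.valueInf γ (it g) s ≤
        ∑ a, (πs s).1 a * (γ * M.next (fun x => M.optValueInf γ x - M.valueInf γ (it g) x) s a) +
        (1 - γ) / η * (∑ a, (πs s).1 a * Real.log ((it (g + 1) s).1 a) -
          ∑ a, (πs s).1 a * Real.log ((it g s).1 a)) +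
        (M.valueInf γ (it (g + 1)) s - M.valueInf γ (it g) s) := by
      intro g hg
      have h2 := avg_mono (πs s) fun a => (hstep g (Finset.mem_range.1 hg)).2.2 s a
      have h3 := hopt s
      have h4 : ∀ a, M.optQInf γ s a - M.qInf γ (it g) s a =
          γ * M.next (fun x => M.optValueInf γ x - M.valueInf γ (it g) x) s a := by
        intro a
        rw [next_sub]
        simp only [optQInf, qInf, backup]
        ring
      simp only [← h4, mul_sub, Finset.sum_sub_distrib]
      simp only [avg_add_const, mul_left_comm _ ((1 - γ) / η), ← Finset.mul_sum, mul_sub,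
        Finset.sum_sub_distrib] at h2
      linarith
    refine (Finset.sum_le_sum h1).trans ?_
    rw [Finset.sum_add_distrib, Finset.sum_add_distrib, ← Finset.mul_sum,
      Finset.sum_range_sub (fun g => ∑ a, (πs s).1 a * Real.log ((it g s).1 a)),
      Finset.sum_range_sub (fun g => M.valueInf γ (it g) s), Finset.sum_comm]
    have h5 : ∑ a, (πs s).1 a * Real.log ((it n s).1 a) ≤ 0 := avg_le _ fun a =>
      Real.log_nonpos ((it n s).2.1 a) (simplex_le_one _ a)
    have h6 : -L ≤ ∑ a, (πs s).1 a * Real.log ((it 0 s).1 a) := le_avg _ fun a =>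
      (abs_le.1 (abs_apply_le_norm (fun s a => Real.log ((it 0 s).1 a)) s a)).1
    have h7 : ∑ a, ∑ g ∈ Finset.range n, (πs s).1 a *
        (γ * M.next (fun x => M.optValueInf γ x - M.valueInf γ (it g) x) s a) ≤ γ * B := by
      simp only [← Finset.mul_sum, ← next_sum]
      exact avg_le _ fun a => mul_le_mul_of_nonneg_left (hM.next_le hB hU s a) hγ₀
    have h8 := mul_le_mul_of_nonneg_left (a := (1 - γ) / η) (sub_le_sub h5 h6) (by positivity)
    have h9 := hV s
    linarith

/-- One step of approximate entropy-regularized NPG.  The deviation of `τ log π + d` from the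
optimal `Q`-function, and its excess over the `Q`-function of `π`, both contract. -/
lemma IsSubMDP.soft_npg_step (hM : M.IsSubMDP) {γ η τ δ : ℝ} (hγ₀ : 0 ≤ γ)
    (hγ₁ : γ < 1) (hη : 0 < η) (hτ : 0 < τ) (hητ : η ≤ (1 - γ) / τ) {π π' : Policy S A}
    {Q : S → A → ℝ} (hQ : ‖Q - M.softQ γ τ π‖ ≤ δ)
    (h : IsNPGStep γ η τ π Q π') (hπ : ∀ s a, 0 < (π s).1 a) {d : S → ℝ} {u m w : ℝ}
    (hu : ∀ s a, |M.optSoftQ γ τ s a - (τ * Real.log ((π s).1 a) + d s)| ≤ u)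
    (hm : ∀ s a, τ * Real.log ((π s).1 a) + d s ≤ M.softQ γ τ π s a + m)
    (hw : ∀ s a, |M.optSoftQ γ τ s a - M.softQ γ τ π s a| ≤ w) :
    (∀ s a, 0 < (π' s).1 a) ∧ ∃ d' : S → ℝ,
      (∀ s a, |M.optSoftQ γ τ s a - (τ * Real.log ((π' s).1 a) + d' s)| ≤
        (1 - η * τ / (1 - γ)) * u + η * τ / (1 - γ) * (w + δ)) ∧
      ∀ s a, τ * Real.log ((π' s).1 a) + d' s ≤ M.softQ γ τ π' s a +
        ((1 - η * τ / (1 - γ)) * m + η * τ / (1 - γ) * δ + 2 * γ * δ / (1 - γ)) := by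
  obtain ⟨hπ', c, hc⟩ := h.log_eq hπ
  have hγ' : 0 < 1 - γ := by linarith
  have hδ : 0 ≤ δ := (norm_nonneg _).trans hQ
  have hQ' : ∀ s a, |Q s a - M.softQ γ τ π s a| ≤ δ := fun s a =>
    (abs_apply_le_norm (Q - M.softQ γ τ π) s a).trans hQ
  set β := η * τ / (1 - γ) with hβ
  have hβ₀ : 0 < β := by positivity
  have hβ₁ : β ≤ 1 := by
    rw [hβ, div_le_one hγ', ← le_div_iff₀ hτ]; exact hητ
  have hηβ : ∀ s a, η * Q s a / (1 - γ) = β * (Q s a / τ) := fun s a => by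
    rw [hβ]; field_simp
  have hlog : ∀ s a, τ * Real.log ((π' s).1 a) =
      (1 - β) * (τ * Real.log ((π s).1 a)) + β * Q s a - τ * c s := fun s a => by
    rw [hc s a, hηβ]; field_simp
  -- Two uses of Gibbs' inequality show that the regularized average of the approximate `Q` does not
  -- decrease from `π` to `π'`. Exchanging `Q` for the exact soft `Q`-function costs `δ` on each
  -- side.
  have himp : ∀ s, M.softValue γ τ π s ≤ regAvg τ (π' s) (M.softQ γ τ π s) + 2 * δ := by
    intro s
    have h1 := mul_nonpos_of_nonneg_of_nonpos hτ.le (gibbs_policy (π := π) hπ' s)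
    have h2 := mul_nonpos_of_nonneg_of_nonpos (mul_nonneg (sub_nonneg.2 hβ₁) hτ.le)
      (gibbs_policy (π := π') hπ s)
    have h3 : τ * ∑ a, (π s).1 a * (Real.log ((π' s).1 a) - Real.log ((π s).1 a)) =
        β * regAvg τ (π s) (Q s) - τ * c s := by
      rw [← avg_const (π s) (τ * c s), regAvg, Finset.mul_sum, Finset.mul_sum,
        ← Finset.sum_sub_distrib]
      refine Finset.sum_congr rfl fun a _ => ?_
      linear_combination (π s).1 a * hlog s a
    have h4 : (1 - β) * τ * ∑ a, (π' s).1 a * (Real.log ((π s).1 a) - Real.log ((π' s).1 a)) =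
        τ * c s - β * regAvg τ (π' s) (Q s) := by
      rw [← avg_const (π' s) (τ * c s), regAvg, Finset.mul_sum, Finset.mul_sum,
        ← Finset.sum_sub_distrib]
      refine Finset.sum_congr rfl fun a _ => ?_
      linear_combination (-(π' s).1 a) * hlog s a
    have h5 : regAvg τ (π s) (Q s) ≤ regAvg τ (π' s) (Q s) := by
      refine le_of_mul_le_mul_left ?_ hβ₀
      linarith
    have h6 := regAvg_le_add (π s) (τ := τ) (q := M.softQ γ τ π s) (q' := Q s) (c := δ)
      fun a => by linarith [(abs_le.1 (hQ' s a)).1]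
    have h7 := regAvg_le_add (π' s) (τ := τ) (q := Q s) (q' := M.softQ γ τ π s) (c := δ)
      fun a => by linarith [(abs_le.1 (hQ' s a)).2]
    rw [hM.softValue_eq hγ₀ hγ₁]
    linarith
  have hV := hM.policy_improvement hγ₀ hγ₁ (by positivity) himp
  -- With this `d'`, `τ log π' + d'` is the convex combination of `τ log π + d` and `Q` with weights
  -- `1 - β` and `β`.
  refine ⟨hπ', fun s => (1 - β) * d s + τ * c s, fun s a => ?_, fun s a => ?_⟩
  · have h1 : M.optSoftQ γ τ s a - (τ * Real.log ((π' s).1 a) + ((1 - β) * d s + τ * c s)) =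
        (1 - β) * (M.optSoftQ γ τ s a - (τ * Real.log ((π s).1 a) + d s)) +
        β * ((M.optSoftQ γ τ s a - M.softQ γ τ π s a) - (Q s a - M.softQ γ τ π s a)) := by
      linear_combination -hlog s a
    rw [h1]
    refine (abs_add_le _ _).trans (add_le_add ?_ ?_)
    · rw [abs_mul, abs_of_nonneg (sub_nonneg.2 hβ₁)]
      exact mul_le_mul_of_nonneg_left (hu s a) (sub_nonneg.2 hβ₁)
    · rw [abs_mul, abs_of_nonneg hβ₀.le]
      exact mul_le_mul_of_nonneg_left ((abs_sub _ _).trans (add_le_add (hw s a) (hQ' s a)))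
        hβ₀.le
  · have h1 : M.softQ γ τ π s a ≤ M.softQ γ τ π' s a + γ * (2 * δ / (1 - γ)) :=
      hM.backup_le_add hγ₀ (by positivity) hV s a
    have h2 := mul_le_mul_of_nonneg_left (hm s a) (sub_nonneg.2 hβ₁)
    have h3 := mul_le_mul_of_nonneg_left (abs_le.1 (hQ' s a)).2 hβ₀.le
    have h4 : 2 * γ * δ / (1 - γ) = γ * (2 * δ / (1 - γ)) := by ring
    rw [h4]
    linarith [hlog s a]

/-- The function `d` lies between the two values up to errors: averaging `τ log π + d - τ log p`
gives `d` for `p = π`, and at most `d` for any other `p` by Gibbs' inequality. -/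
lemma IsSubMDP.optSoftValue_le [Nonempty A] (hM : M.IsSubMDP) {γ τ : ℝ} (hγ₀ : 0 ≤ γ)
    (hγ₁ : γ < 1) (hτ : 0 < τ) {π : Policy S A} (hπ : ∀ s a, 0 < (π s).1 a) {d : S → ℝ} {u m : ℝ}
    (hu : ∀ s a, |M.optSoftQ γ τ s a - (τ * Real.log ((π s).1 a) + d s)| ≤ u)
    (hm : ∀ s a, τ * Real.log ((π s).1 a) + d s ≤ M.softQ γ τ π s a + m) (s : S) :
    M.optSoftValue γ τ s ≤ M.softValue γ τ π s + (u + m) := by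
  obtain ⟨-, -, πs, -, hopt⟩ := hM.bellman_optimality hγ₀ hγ₁ τ
  have h1 : d s ≤ M.softValue γ τ π s + m := by
    rw [hM.softValue_eq hγ₀ hγ₁]
    have := regAvg_le_add (π s) (τ := τ) (hm s)
    simp only [regAvg, add_sub_cancel_left, avg_const] at this
    exact this
  have h2 : M.optSoftValue γ τ s ≤ d s + u := by
    rw [hopt s]
    refine (regAvg_le_add (πs s) (q' := fun a => τ * Real.log ((π s).1 a) + d s) (c := u)
      fun a => by linarith [(abs_le.1 (hu s a)).2]).trans ?_
    have h3 := mul_nonpos_of_nonneg_of_nonpos hτ.le (gibbs_policy (π := πs) hπ s)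
    have h4 : regAvg τ (πs s) (fun a => τ * Real.log ((π s).1 a) + d s) =
        τ * ∑ a, (πs s).1 a * (Real.log ((π s).1 a) - Real.log ((πs s).1 a)) + d s := by
      rw [← avg_const (πs s) (d s), regAvg, Finset.mul_sum, ← Finset.sum_add_distrib]
      refine Finset.sum_congr rfl fun a _ => ?_
      rw [avg_const]
      ring
    linarith
  linarith

/-- This identifies the log-partition function with `V_τ^*`. It is at most `V_τ^*` because the
softmax policy is a competitor, and at least `V_τ^*` by Gibbs' inequality. -/
lemma IsSubMDP.log_optSoftPolicy [Nonempty A] (hM : M.IsSubMDP) {γ τ : ℝ} (hγ₀ : 0 ≤ γ)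
    (hγ₁ : γ < 1) (hτ : 0 < τ) (s : S) (a : A) :
    τ * Real.log (M.optSoftPolicy γ τ s a) = M.optSoftQ γ τ s a - M.optSoftValue γ τ s := by
  obtain ⟨-, hle, πs, -, hopt⟩ := hM.bellman_optimality hγ₀ hγ₁ τ
  have hZ : 0 < ∑ b, Real.exp (M.optSoftQ γ τ s b / τ) :=
    Finset.sum_pos (fun b _ => Real.exp_pos _) Finset.univ_nonempty
  have hpos : ∀ a, 0 < M.optSoftPolicy γ τ s a := fun a => div_pos (Real.exp_pos _) hZ
  have hsum : ∑ a, M.optSoftPolicy γ τ s a = 1 := by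
    simp only [optSoftPolicy, ← Finset.sum_div, div_self hZ.ne']
  have hlog : ∀ a, τ * Real.log (M.optSoftPolicy γ τ s a) =
      M.optSoftQ γ τ s a - τ * Real.log (∑ b, Real.exp (M.optSoftQ γ τ s b / τ)) := by
    intro a
    rw [optSoftPolicy, Real.log_div (Real.exp_pos _).ne' hZ.ne', Real.log_exp]
    field_simp
  have h1 := hle ⟨M.optSoftPolicy γ τ s, fun a => (hpos a).le, hsum⟩ s
  simp only [regAvg, hlog, sub_sub_cancel, ← Finset.sum_mul, hsum, one_mul] at h1
  have h2 := mul_nonpos_of_nonneg_of_nonpos hτ.le (gibbs (πs s) hpos hsum.le)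
  have h3 : τ * ∑ a, (πs s).1 a * (Real.log (M.optSoftPolicy γ τ s a) - Real.log ((πs s).1 a)) =
      M.optSoftValue γ τ s - τ * Real.log (∑ b, Real.exp (M.optSoftQ γ τ s b / τ)) := by
    rw [hopt s, regAvg, ← avg_const (πs s) (τ * Real.log (∑ b, Real.exp (M.optSoftQ γ τ s b / τ))),
      Finset.mul_sum, ← Finset.sum_sub_distrib]
    refine Finset.sum_congr rfl fun a _ => ?_
    linear_combination (πs s).1 a * hlog a
  rw [hlog a]
  linarith

/-- Convergence of entropy-regularized natural policy gradient with approximate values. -/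
theorem IsSubMDP.soft_npg_bound [Nonempty A] (hM : M.IsSubMDP) {γ η τ δ : ℝ} (hγ₀ : 0 ≤ γ)
    (hγ₁ : γ < 1) (hη : 0 < η) (hτ : 0 < τ) (hητ : η ≤ (1 - γ) / τ) {n : ℕ} (hn : 1 ≤ n)
    {π₀ π : Policy S A} (hπ₀ : ∀ s a, 0 < (π₀ s).1 a) (h : IsSoftNPG M γ η τ δ n π₀ π) (s : S) :
    M.optSoftValue γ τ s - M.softValue γ τ π s ≤
      (1 - η * τ) ^ (n - 1) * (‖M.optSoftQ γ τ - M.softQ γ τ π₀‖ +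
        2 * τ * (1 - η * τ / (1 - γ)) * ‖fun s a => Real.log (M.optSoftPolicy γ τ s a) -
          Real.log ((π₀ s).1 a)‖) + 2 * δ / (1 - γ) * (1 + γ / (η * τ)) := by
  obtain ⟨it, Q, rfl, rfl, hit⟩ := h
  obtain ⟨m, rfl⟩ : ∃ m, n = m + 1 := ⟨n - 1, by lia⟩
  have hγ' : 0 < 1 - γ := by linarith
  have hδ : 0 ≤ δ := (norm_nonneg _).trans (hit 0 (by lia)).1
  set N := ‖fun s a => Real.log (M.optSoftPolicy γ τ s a) - Real.log ((it 0 s).1 a)‖ with hN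
  set w := ‖M.optSoftQ γ τ - M.softQ γ τ (it 0)‖ with hw
  set C := w + 2 * τ * (1 - η * τ / (1 - γ)) * N with hC
  have hητ₀ : 0 < η * τ := by positivity
  have hητ₁ : η * τ ≤ 1 - γ := (le_div_iff₀ hτ).1 hητ
  have key : ∀ g ≤ m, (∀ s a, 0 < (it (g + 1) s).1 a) ∧ ∃ (d : S → ℝ) (u v : ℝ),
      (∀ s a, |M.optSoftQ γ τ s a - (τ * Real.log ((it (g + 1) s).1 a) + d s)| ≤ u) ∧
      (∀ s a, τ * Real.log ((it (g + 1) s).1 a) + d s ≤ M.softQ γ τ (it (g + 1)) s a + v) ∧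
      u + v ≤ (1 - η * τ) ^ g * C + 2 * δ / (1 - γ) * (1 + γ / (η * τ)) := by
    intro g
    induction g with
    -- The first update starts from `d = V_τ^*`, `u = τN` and `m = τN + w`. It turns `u + m` into
    -- `(1-β)(2τN + w) + βw = C` plus evaluation errors, where `β = ητ/(1-γ)`. As it is spent on
    -- this, the exponent is `n - 1`.
    | zero =>
      intro _
      obtain ⟨hQ, hs⟩ := hit 0 (by lia)
      have hu : ∀ s a, |M.optSoftQ γ τ s a -
          (τ * Real.log ((it 0 s).1 a) + M.optSoftValue γ τ s)| ≤ τ * N := by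
        intro s a
        have h1 := hM.log_optSoftPolicy hγ₀ hγ₁ hτ s a
        have h2 : M.optSoftQ γ τ s a - (τ * Real.log ((it 0 s).1 a) + M.optSoftValue γ τ s) =
            τ * (Real.log (M.optSoftPolicy γ τ s a) - Real.log ((it 0 s).1 a)) := by
          linear_combination -h1
        rw [h2, abs_mul, abs_of_pos hτ]
        exact mul_le_mul_of_nonneg_left (abs_apply_le_norm (fun s a =>
          Real.log (M.optSoftPolicy γ τ s a) - Real.log ((it 0 s).1 a)) s a) hτ.le
      have hw' : ∀ s a, |M.optSoftQ γ τ s a - M.softQ γ τ (it 0) s a| ≤ w := fun s a =>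
        abs_apply_le_norm (M.optSoftQ γ τ - M.softQ γ τ (it 0)) s a
      obtain ⟨hpos, d, h1, h2⟩ := hM.soft_npg_step hγ₀ hγ₁ hη hτ hητ hQ hs hπ₀
        (m := τ * N + w) hu
        (fun s a => by linarith [(abs_le.1 (hu s a)).1, (abs_le.1 (hw' s a)).2]) hw'
      refine ⟨hpos, d, _, _, h1, h2, ?_⟩
      have h3 : 2 * (η * τ / (1 - γ) * δ) + 2 * γ * δ / (1 - γ) ≤
          2 * δ / (1 - γ) * (1 + γ / (η * τ)) := by
        have h4 : 2 * (η * τ / (1 - γ) * δ) + 2 * γ * δ / (1 - γ) =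
            η * τ * (2 * δ / (1 - γ) * (1 + γ / (η * τ))) := by
          field_simp
        rw [h4]
        exact mul_le_of_le_one_left (by positivity) (by linarith)
      rw [pow_zero, one_mul, hC]
      linarith
    | succ g ih =>
      intro hg
      obtain ⟨hpos, d, u, v, hu, hv, huv⟩ := ih (by lia)
      obtain ⟨hQ, hs⟩ := hit (g + 1) (by lia)
      have hle := (hM.bellman_optimality hγ₀ hγ₁ τ).1
      have huv₀ : 0 ≤ u + v := by
        have h1 := hM.optSoftValue_le hγ₀ hγ₁ hτ hpos hu hv s
        linarith [hle (it (g + 1)) s]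
      have hw' : ∀ s a, |M.optSoftQ γ τ s a - M.softQ γ τ (it (g + 1)) s a| ≤ γ * (u + v) := by
        intro s a
        have h1 : M.optSoftQ γ τ s a ≤ M.softQ γ τ (it (g + 1)) s a + γ * (u + v) :=
          hM.backup_le_add hγ₀ huv₀ (hM.optSoftValue_le hγ₀ hγ₁ hτ hpos hu hv) s a
        have h2 : M.softQ γ τ (it (g + 1)) s a ≤ M.optSoftQ γ τ s a + γ * 0 :=
          hM.backup_le_add hγ₀ le_rfl (fun s => by linarith [hle (it (g + 1)) s]) s a
        have h3 : 0 ≤ γ * (u + v) := by positivity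
        rw [abs_le]
        constructor <;> linarith
      obtain ⟨hpos', d', h1, h2⟩ := hM.soft_npg_step hγ₀ hγ₁ hη hτ hητ hQ hs hpos hu hv hw'
      refine ⟨hpos', d', _, _, h1, h2, ?_⟩
      -- With `w = γ(u + v)` the factor is `1 - β + βγ = 1 - ητ`. The remaining error is `ητ` times
      -- the additive constant of the claim, which is thus a fixed point of the recursion.
      have h3 : (1 - η * τ / (1 - γ)) * u + η * τ / (1 - γ) * (γ * (u + v) + δ) +
          ((1 - η * τ / (1 - γ)) * v + η * τ / (1 - γ) * δ + 2 * γ * δ / (1 - γ)) =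
          (1 - η * τ) * (u + v) + η * τ * (2 * δ / (1 - γ) * (1 + γ / (η * τ))) := by
        field_simp
        ring
      rw [h3, pow_succ]
      have h4 := mul_le_mul_of_nonneg_left huv (by linarith : (0 : ℝ) ≤ 1 - η * τ)
      linarith
  obtain ⟨hpos, d, u, v, hu, hv, huv⟩ := key m le_rfl
  have := hM.optSoftValue_le hγ₀ hγ₁ hτ hpos hu hv s
  rw [Nat.add_sub_cancel]
  linarith

/-- Suboptimality, in the unregularized problem, of the policy that entropy-regularized natural
policy gradient computes. -/
theorem IsSubMDP.optValueInf_sub_le_of_softValue [Nonempty A] (hM : M.IsSubMDP) {γ τ : ℝ}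
    (hγ₀ : 0 ≤ γ) (hγ₁ : γ < 1) (hτ : 0 ≤ τ) (π : Policy S A) (s : S) :
    M.optValueInf γ s - M.valueInf γ π s ≤ M.optSoftValue γ τ s - M.softValue γ τ π s +
      τ * Real.log (Fintype.card A) / (1 - γ) := by
  obtain ⟨-, -, πs, hπs, -⟩ := hM.bellman_optimality hγ₀ hγ₁ 0
  rw [softValue_zero, optSoftValue_zero] at hπs
  have h1 := (hM.bellman_optimality hγ₀ hγ₁ τ).1 πs s
  have h2 := mul_nonneg hτ (hM.entropy_nonneg hγ₀ hγ₁ πs s)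
  have h3 := mul_le_mul_of_nonneg_left (hM.entropy_le hγ₀ hγ₁ π s) hτ
  rw [← hπs, mul_div_assoc]
  simp only [softValue] at h1 ⊢
  linarith

end Model

end ProST

/-! ### Regret of one episode. -/

namespace ProST

namespace Model

variable {S A : Type*} [Fintype S] [Fintype A] {M M' : Model S A}

lemma IsSubMDP.valueInf_le_value (hM : M.IsSubMDP) {γ r : ℝ} (hγ₀ : 0 ≤ γ) (hγ₁ : γ < 1)
    (hr₀ : 0 ≤ r) (hr : ∀ s a, |M.R s a| ≤ r) (n : ℕ) (π : Policy S A) (s : S) :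
    M.valueInf γ π s ≤ M.value γ n (fun _ => π) s + γ ^ n * r / (1 - γ) := by
  have hγ' : 0 < 1 - γ := by linarith
  induction n generalizing s with
  | zero =>
    rw [value_zero, pow_zero, one_mul, zero_add]
    exact (abs_le.1 (hM.abs_valueInf_le hγ₀ hγ₁ hr₀ hr π s)).2
  | succ n ih =>
    rw [hM.valueInf_eq hγ₀ hγ₁, value_succ, ← avg_add_const]
    refine avg_mono _ fun a => (hM.backup_le_add hγ₀ (by positivity) ih s a).trans_eq ?_
    ring

/-- Backing up `V̂^*` in the true model instead of the forecast costs `‖ῑ_∞‖`. Discounted over the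
steps this sums to `‖ῑ_∞‖/(1-γ)`, and the horizon term comes from comparing the value `0` at the end
with `V̂^* ≥ -r/(1-γ)`. -/
lemma IsSubMDP.value_le_optValueInf_add [Nonempty A] (hM : M.IsSubMDP) (hM' : M'.IsSubMDP)
    {γ r : ℝ} (hγ₀ : 0 ≤ γ) (hγ₁ : γ < 1) (hr₀ : 0 ≤ r) (hr : ∀ s a, |M'.R s a| ≤ r) (n : ℕ)
    (π : ℕ → Policy S A) (s : S) :
    M.value γ n π s ≤ M'.optValueInf γ s + (‖optModelError M M' γ‖ / (1 - γ) +
      γ ^ n * r / (1 - γ)) := by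
  have hγ' : 0 < 1 - γ := by linarith
  obtain ⟨-, hle, πs, hπs, -⟩ := hM'.bellman_optimality hγ₀ hγ₁ 0
  rw [softValue_zero, optSoftValue_zero] at hπs
  simp only [optSoftValue_zero, optSoftQ_zero, regAvg_zero] at hle
  induction n generalizing π s with
  | zero =>
    rw [value_zero, pow_zero, one_mul, ← hπs]
    have h1 := (abs_le.1 (hM'.abs_valueInf_le hγ₀ hγ₁ hr₀ hr πs s)).1
    have : 0 ≤ ‖optModelError M M' γ‖ / (1 - γ) := by positivity
    linarith
  | succ n ih =>
    rw [value_succ]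
    have h1 : ∀ a, M.backup γ (M.value γ n fun i => π (i + 1)) s a ≤ M'.optQInf γ s a +
        (‖optModelError M M' γ‖ / (1 - γ) + γ ^ (n + 1) * r / (1 - γ)) := by
      intro a
      refine (hM.backup_le_add hγ₀ (by positivity) (ih _) s a).trans ?_
      have h2 := (abs_le.1 (abs_apply_le_norm (optModelError M M' γ) s a)).2
      have h3 : optModelError M M' γ s a = M.backup γ (M'.optValueInf γ) s a - M'.optQInf γ s a :=
        rfl
      have h4 : ‖optModelError M M' γ‖ + γ * (‖optModelError M M' γ‖ / (1 - γ) +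
          γ ^ n * r / (1 - γ)) = ‖optModelError M M' γ‖ / (1 - γ) + γ ^ (n + 1) * r / (1 - γ) := by
        field_simp
        ring
      linarith
    refine (avg_mono _ h1).trans ?_
    rw [avg_add_const]
    linarith [hle (π 0 s) s]

lemma IsSubMDP.optValue_le_optValueInf_add [Nonempty A] (hM : M.IsSubMDP) (hM' : M'.IsSubMDP)
    {γ r : ℝ} (hγ₀ : 0 ≤ γ) (hγ₁ : γ < 1) (hr₀ : 0 ≤ r) (hr : ∀ s a, |M'.R s a| ≤ r) (n : ℕ)
    (s : S) :
    M.optValue γ n s ≤ M'.optValueInf γ s + (‖optModelError M M' γ‖ / (1 - γ) +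
      γ ^ n * r / (1 - γ)) := by
  classical
  have : Nonempty (ℕ → Policy S A) :=
    ⟨fun _ _ => ⟨_, single_mem_stdSimplex ℝ (Classical.arbitrary A)⟩⟩
  exact ciSup_le fun π => hM.value_le_optValueInf_add hM' hγ₀ hγ₁ hr₀ hr n π s

end Model

variable {S A : Type*} [Fintype S] [Fintype A] {M M' : Model S A}

/-- `V̂_h - V_h`: the error of the values of `π` in the forecast `M'` of `M`. -/
noncomputable def valueError (M M' : Model S A) (γ : ℝ) (H : ℕ) (π : Policy S A) (h : ℕ) (s : S) :
    ℝ :=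
  M'.stepValue γ H π h s - M.stepValue γ H π h s

/-- The change of the value error, corrected by the model error, when `a` is played in a state at
step `h` and `s'` is reached. -/
noncomputable def errorStep (M M' : Model S A) (γ : ℝ) (H : ℕ) (π : Policy S A) (h : ℕ)
    (s : S) (a : A) (s' : S) : ℝ :=
  modelError M M' γ H π h s a - γ * valueError M M' γ H π (h + 1) s'

/-- The value errors telescope, and the last one vanishes because no steps are left at time `H`. -/
lemma sum_errorStep (γ : ℝ) (H : ℕ) (π : Policy S A) (x : ℕ → S) (y : ℕ → A) :
    ∑ h ∈ Finset.range H, γ ^ h * (errorStep M M' γ H π h (x h) (y h) (x (h + 1)) +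
        valueError M M' γ H π h (x h)) =
      ∑ h ∈ Finset.range H, γ ^ h * modelError M M' γ H π h (x h) (y h) +
        valueError M M' γ H π 0 (x 0) := by
  have h1 : ∀ h, γ ^ h * (errorStep M M' γ H π h (x h) (y h) (x (h + 1)) +
      valueError M M' γ H π h (x h)) = γ ^ h * modelError M M' γ H π h (x h) (y h) +
      (γ ^ h * valueError M M' γ H π h (x h) -
        γ ^ (h + 1) * valueError M M' γ H π (h + 1) (x (h + 1))) := by
    intro h
    rw [errorStep]
    ring
  simp only [h1, Finset.sum_add_distrib]
  rw [Finset.sum_range_sub' (fun h => γ ^ h * valueError M M' γ H π h (x h))]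
  simp [valueError, Model.stepValue, Model.value_zero]

lemma stepValue_eq (γ : ℝ) {H h : ℕ} (hh : h < H) (π : Policy S A) (s : S) :
    M.stepValue γ H π h s = ∑ a, (π s).1 a * M.stepQ γ H π h s a := by
  have : H - h = (H - (h + 1)) + 1 := by lia
  rw [Model.stepValue, this, Model.value_succ]
  rfl

/-- The correction has mean zero under the true model. -/
lemma avg_errorStep (hM : M.IsMDP) (γ : ℝ) {H h : ℕ} (hh : h < H) (π : Policy S A) (s : S) :
    ∑ a, ∑ s', (π s).1 a * M.P s a s' * errorStep M M' γ H π h s a s' =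
      -valueError M M' γ H π h s := by
  have h1 : ∀ a, ∑ s', (π s).1 a * M.P s a s' * errorStep M M' γ H π h s a s' =
      (π s).1 a * M.stepQ γ H π h s a - (π s).1 a * M'.stepQ γ H π h s a := by
    intro a
    -- Here the true kernel must have mass exactly one: the model error does not depend on `s'` and
    -- has to be reproduced by the average.
    have h2 : ∑ s', M.P s a s' * errorStep M M' γ H π h s a s' =
        modelError M M' γ H π h s a - γ * M.next (valueError M M' γ H π (h + 1)) s a := by
      simp only [errorStep, mul_sub, Finset.sum_sub_distrib, ← Finset.sum_mul, hM.2, one_mul,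
        Model.next, Finset.mul_sum, mul_left_comm γ]
    have h3 : M.next (valueError M M' γ H π (h + 1)) s a =
        M.next (M'.stepValue γ H π (h + 1)) s a - M.next (M.stepValue γ H π (h + 1)) s a :=
      Model.next_sub _ _ _ _
    simp only [mul_assoc, ← Finset.mul_sum, h2, h3, modelError, Pi.sub_apply]
    simp only [Model.stepQ, Model.backup]
    ring
  simp only [h1, Finset.sum_sub_distrib, ← stepValue_eq γ hh, valueError]
  ring

lemma abs_errorStep_le (hM : M.IsSubMDP) (hM' : M'.IsSubMDP) {γ r : ℝ} (hγ₀ : 0 ≤ γ)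
    (hr : ∀ s a, |M.R s a| ≤ r) (hr' : ∀ s a, |M'.R s a| ≤ r) {H h : ℕ}
    (π : Policy S A) (s : S) (a : A) (s' : S) :
    |errorStep M M' γ H π h s a s'| ≤
      r * (2 + 4 * γ * ∑ i ∈ Finset.range (H - (h + 1)), γ ^ i) := by
  set v := ∑ i ∈ Finset.range (H - (h + 1)), γ ^ i
  have hV : ∀ s, |M.stepValue γ H π (h + 1) s| ≤ r * v := hM.abs_value_le hγ₀ hr _ _
  have hV' : ∀ s, |M'.stepValue γ H π (h + 1) s| ≤ r * v := hM'.abs_value_le hγ₀ hr' _ _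
  -- Two rewards and four values remain, whence the constants `2` and `4`.
  have e : errorStep M M' γ H π h s a s' = M.R s a - M'.R s a +
      γ * (M.next (M'.stepValue γ H π (h + 1)) s a - M'.next (M'.stepValue γ H π (h + 1)) s a +
        (M.stepValue γ H π (h + 1) s' - M'.stepValue γ H π (h + 1) s')) := by
    simp only [errorStep, modelError, valueError, Pi.sub_apply, Model.stepQ, Model.backup]
    ring
  rw [e]
  have h1 := abs_le.1 (hr s a)
  have h2 := abs_le.1 (hr' s a)
  have h3 := abs_le.1 (hM.abs_next_le hV' s a)
  have h4 := abs_le.1 (hM'.abs_next_le hV' s a)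
  have h5 := abs_le.1 (hV s')
  have h6 := abs_le.1 (hV' s')
  have h7 : |γ * (M.next (M'.stepValue γ H π (h + 1)) s a -
      M'.next (M'.stepValue γ H π (h + 1)) s a +
        (M.stepValue γ H π (h + 1) s' - M'.stepValue γ H π (h + 1) s'))| ≤ γ * (4 * (r * v)) := by
    rw [abs_mul, abs_of_nonneg hγ₀]
    refine mul_le_mul_of_nonneg_left (abs_le.2 ⟨?_, ?_⟩) hγ₀ <;> linarith
  have h8 : |M.R s a - M'.R s a| ≤ 2 * r := abs_le.2 ⟨by linarith, by linarith⟩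
  refine (abs_add_le _ _).trans ((add_le_add h8 h7).trans_eq ?_)
  ring

/-- Each bound equals `4/(1-γ)` times some `x h` in `[0, 1]`. Bounding every `x h ^ 2` by one would
give `16H`; the sharper `8H` uses that the `x h` sum to at most `H/2`. -/
lemma sum_sq_errorStep_bound_le {γ : ℝ} (hγ₀ : 0 ≤ γ) (hγ₁ : γ < 1) (H : ℕ) :
    ∑ h ∈ Finset.range H, (γ ^ h * (2 + 4 * γ * ∑ i ∈ Finset.range (H - (h + 1)), γ ^ i)) ^ 2 ≤
      8 * H / (1 - γ) ^ 2 := by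
  have hγ' : 0 < 1 - γ := by linarith
  set x : ℕ → ℝ := fun h => (γ ^ h + γ ^ (h + 1)) / 2 - γ ^ H with hx
  have h1 : ∀ h ∈ Finset.range H,
      (γ ^ h * (2 + 4 * γ * ∑ i ∈ Finset.range (H - (h + 1)), γ ^ i)) ^ 2 =
        16 / (1 - γ) ^ 2 * x h ^ 2 := by
    intro h hh
    have hh := Finset.mem_range.1 hh
    have e : γ ^ H = γ ^ h * γ * γ ^ (H - (h + 1)) := by
      rw [← pow_succ, ← pow_add]; congr 1; lia
    have hg : ∑ i ∈ Finset.range (H - (h + 1)), γ ^ i = (1 - γ ^ (H - (h + 1))) / (1 - γ) := by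
      rw [eq_div_iff hγ'.ne', geom_sum_mul_neg]
    rw [hg, hx]
    simp only [e]
    field_simp
    ring
  have hx01 : ∀ h ∈ Finset.range H, x h ^ 2 ≤ x h := by
    intro h hh
    have hh := Finset.mem_range.1 hh
    have h2 : γ ^ H ≤ γ ^ h := pow_le_pow_of_le_one hγ₀ hγ₁.le hh.le
    have h3 : γ ^ H ≤ γ ^ (h + 1) := pow_le_pow_of_le_one hγ₀ hγ₁.le hh
    have h4 : γ ^ h ≤ 1 := pow_le_one₀ hγ₀ hγ₁.le
    have h5 : γ ^ (h + 1) ≤ 1 := pow_le_one₀ hγ₀ hγ₁.le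
    have h6 : 0 ≤ γ ^ H := pow_nonneg hγ₀ _
    have h7 : 0 ≤ x h := by simp only [hx]; linarith
    have h8 : x h ≤ 1 := by simp only [hx]; linarith
    nlinarith
  have hsum : ∑ h ∈ Finset.range H, x h ≤ H / 2 := by
    -- Reversing the second half of the sum pairs `a = γ^h` with `b = γ^(H-h)`, where `ab = γ^H`.
    -- Then `(a+b)/2 - ab ≤ 1/2`, because `(1-a)(1-b) + ab ≥ 0`.
    have h2 : ∑ h ∈ Finset.range H, γ ^ (h + 1) = ∑ h ∈ Finset.range H, γ ^ (H - h) := by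
      rw [← Finset.sum_range_reflect]
      refine Finset.sum_congr rfl fun h hh => ?_
      have hh := Finset.mem_range.1 hh
      congr 1; lia
    have h3 : ∑ h ∈ Finset.range H, x h =
        ∑ h ∈ Finset.range H, ((γ ^ h + γ ^ (H - h)) / 2 - γ ^ H) := by
      simp only [hx, Finset.sum_sub_distrib, ← Finset.sum_div, Finset.sum_add_distrib, h2]
    have h4 : ∀ h ∈ Finset.range H, (γ ^ h + γ ^ (H - h)) / 2 - γ ^ H ≤ 1 / 2 := by
      intro h hh
      have hh := Finset.mem_range.1 hh
      have e : γ ^ H = γ ^ h * γ ^ (H - h) := by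
        rw [← pow_add]; congr 1; lia
      have h5 : γ ^ h ≤ 1 := pow_le_one₀ hγ₀ hγ₁.le
      have h6 : γ ^ (H - h) ≤ 1 := pow_le_one₀ hγ₀ hγ₁.le
      have h7 : 0 ≤ γ ^ H := pow_nonneg hγ₀ _
      nlinarith [mul_nonneg (sub_nonneg.2 h5) (sub_nonneg.2 h6)]
    rw [h3]
    refine (Finset.sum_le_sum h4).trans_eq ?_
    simp [div_eq_mul_inv]
  rw [Finset.sum_congr rfl h1, ← Finset.mul_sum]
  calc _ ≤ 16 / (1 - γ) ^ 2 * (H / 2 : ℝ) :=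
        mul_le_mul_of_nonneg_left ((Finset.sum_le_sum hx01).trans hsum) (by positivity)
    _ = _ := by ring

/-- Regret of one episode. -/
theorem episode_regret_le [Nonempty A] (hM : M.IsMDP) (hM' : M'.IsSubMDP) {γ r : ℝ} (hγ₀ : 0 ≤ γ)
    (hγ₁ : γ < 1) (hr₀ : 0 ≤ r) (hr' : ∀ s a, |M'.R s a| ≤ r) (H : ℕ) (π : Policy S A)
    (x : ℕ → S) (y : ℕ → A) :
    M.optValue γ H (x 0) - M.value γ H (fun _ => π) (x 0) ≤
      ‖optModelError M M' γ‖ / (1 - γ) -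
      ∑ h ∈ Finset.range H, γ ^ h * modelError M M' γ H π h (x h) (y h) +
      ∑ h ∈ Finset.range H, γ ^ h * (errorStep M M' γ H π h (x h) (y h) (x (h + 1)) +
        valueError M M' γ H π h (x h)) +
      (M'.optValueInf γ (x 0) - M'.valueInf γ π (x 0)) + 2 * γ ^ H * r / (1 - γ) := by
  have h1 := hM.isSubMDP.optValue_le_optValueInf_add hM' hγ₀ hγ₁ hr₀ hr' H (x 0)
  have h2 := hM'.valueInf_le_value hγ₀ hγ₁ hr₀ hr' H π (x 0)
  have h3 := sum_errorStep (M := M) (M' := M') γ H π x y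
  have h4 : valueError M M' γ H π 0 (x 0) = M'.value γ H (fun _ => π) (x 0) -
      M.value γ H (fun _ => π) (x 0) := rfl
  have h5 : 2 * γ ^ H * r / (1 - γ) = γ ^ H * r / (1 - γ) + γ ^ H * r / (1 - γ) := by ring
  linarith

end ProST

/-! ### Hoeffding's lemma and the one-step exponential estimate. -/

namespace ProST

/-- Hoeffding's lemma for a finite distribution. -/
lemma hoeffding_finite {ι : Type*} [Fintype ι] {p g : ι → ℝ} {b w : ℝ} (hp : ∀ i, 0 ≤ p i)
    (hp₁ : ∑ i, p i = 1) (hg : ∀ i, |g i| ≤ b) (hw : ∑ i, p i * g i = w) (l : ℝ) :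
    ∑ i, p i * Real.exp (l * (g i - w)) ≤ Real.exp (l ^ 2 * b ^ 2 / 2) := by
  let _ : MeasurableSpace ι := ⊤
  let P : PMF ι := PMF.ofFintype (fun i => ENNReal.ofReal (p i)) (by
    rw [← ENNReal.ofReal_sum_of_nonneg fun i _ => hp i, hp₁, ENNReal.ofReal_one])
  have hP : ∀ f : ι → ℝ, ∫ i, f i ∂P.toMeasure = ∑ i, p i * f i := by
    intro f
    rw [PMF.integral_eq_sum]
    refine Finset.sum_congr rfl fun i _ => ?_
    simp only [P, PMF.ofFintype_apply, ENNReal.toReal_ofReal (hp i), smul_eq_mul]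
  -- The centered variable may exceed `b`, but the uncentered one lies in an interval of length
  -- `2b`, which gives variance proxy `b²`.
  have h := (ProbabilityTheory.hasSubgaussianMGF_of_mem_Icc (μ := P.toMeasure) (X := g)
    (a := -b) (b := b) (measurable_from_top.aemeasurable)
    (Filter.Eventually.of_forall fun i => abs_le.1 (hg i))).mgf_le l
  rw [ProbabilityTheory.mgf, hP, hP, hw] at h
  refine h.trans_eq ?_
  congr 1
  have : |b + b| / 2 = |b| := by rw [← two_mul, abs_mul]; norm_num
  simp [this]
  ring

lemma hoeffding_cosh {ι : Type*} [Fintype ι] {p g : ι → ℝ} {b w : ℝ} (hp : ∀ i, 0 ≤ p i)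
    (hp₁ : ∑ i, p i = 1) (hg : ∀ i, |g i| ≤ b) (hw : ∑ i, p i * g i = w) (l z : ℝ) :
    ∑ i, p i * Real.cosh (l * (z + (g i - w))) ≤
      Real.exp (l ^ 2 * b ^ 2 / 2) * Real.cosh (l * z) := by
  have h1 := hoeffding_finite hp hp₁ hg hw l
  have h2 := hoeffding_finite hp hp₁ hg hw (-l)
  rw [neg_sq] at h2
  have e : ∑ i, p i * Real.cosh (l * (z + (g i - w))) =
      Real.exp (l * z) / 2 * ∑ i, p i * Real.exp (l * (g i - w)) +
      Real.exp (-(l * z)) / 2 * ∑ i, p i * Real.exp (-l * (g i - w)) := by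
    rw [Finset.mul_sum, Finset.mul_sum, ← Finset.sum_add_distrib]
    refine Finset.sum_congr rfl fun i _ => ?_
    rw [Real.cosh_eq, show l * (z + (g i - w)) = l * z + l * (g i - w) by ring, Real.exp_add,
      show -(l * z + l * (g i - w)) = -(l * z) + -l * (g i - w) by ring, Real.exp_add]
    ring
  rw [e, Real.cosh_eq]
  have h3 := mul_le_mul_of_nonneg_left h1 (by positivity : 0 ≤ Real.exp (l * z) / 2)
  have h4 := mul_le_mul_of_nonneg_left h2 (by positivity : 0 ≤ Real.exp (-(l * z)) / 2)
  linarith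

lemma measurable_select {Ω ι : Type*} [MeasurableSpace Ω] [Finite ι] {Y : Ω → ι}
    (hY : ∀ i, MeasurableSet {ω | Y ω = i}) {f : ι → Ω → ℝ} (hf : ∀ i, Measurable (f i)) :
    Measurable fun ω => f (Y ω) ω := by
  intro t ht
  have : (fun ω => f (Y ω) ω) ⁻¹' t = ⋃ i, {ω | Y ω = i} ∩ f i ⁻¹' t := by
    ext ω; simp
  rw [this]
  exact MeasurableSet.iUnion fun i => (hY i).inter (hf i ht)

section Measurability

variable {Ω S A : Type*} [MeasurableSpace Ω] [Fintype S] {F F' : Ω → Model S A}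

/-- The entries of a random model are measurable. -/
structure MeasurableModel (F : Ω → Model S A) : Prop where
  P : ∀ s a s', Measurable fun ω => (F ω).P s a s'
  R : ∀ s a, Measurable fun ω => (F ω).R s a

lemma MeasurableModel.backup (hF : MeasurableModel F) {V : Ω → S → ℝ}
    (hV : ∀ s, Measurable fun ω => V ω s) (γ : ℝ) (s : S) (a : A) :
    Measurable fun ω => (F ω).backup γ (V ω) s a :=
  (hF.R s a).add ((Finset.measurable_sum _ fun s' _ => (hF.P s a s').mul (hV s')).const_mul γ)

variable [Fintype A] {π : Ω → Policy S A}

lemma MeasurableModel.stepValue (hF : MeasurableModel F)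
    (hπ : ∀ s a, Measurable fun ω => (π ω s).1 a) (γ : ℝ) (H h : ℕ) (s : S) :
    Measurable fun ω => (F ω).stepValue γ H (π ω) h s := by
  have h1 : ∀ n s, Measurable fun ω => (F ω).expect (F ω).R n (fun _ => π ω) s := by
    intro n
    induction n with
    | zero =>
      intro s
      exact Finset.measurable_sum _ fun a _ => (hπ s a).mul (hF.R s a)
    | succ n ih =>
      intro s
      exact Finset.measurable_sum _ fun a _ => (hπ s a).mul
        (Finset.measurable_sum _ fun s' _ => (hF.P s a s').mul (ih s'))
  change Measurable fun ω => ∑ n ∈ Finset.range (H - h),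
    γ ^ n * (F ω).expect (F ω).R n (fun _ => π ω) s
  exact Finset.measurable_sum _ fun n _ => (h1 n s).const_mul _

lemma MeasurableModel.valueError (hF : MeasurableModel F) (hF' : MeasurableModel F')
    (hπ : ∀ s a, Measurable fun ω => (π ω s).1 a) (γ : ℝ) (H h : ℕ) (s : S) :
    Measurable fun ω => ProST.valueError (F ω) (F' ω) γ H (π ω) h s :=
  (hF'.stepValue hπ γ H h s).sub (hF.stepValue hπ γ H h s)

lemma MeasurableModel.errorStep (hF : MeasurableModel F) (hF' : MeasurableModel F')
    (hπ : ∀ s a, Measurable fun ω => (π ω s).1 a) (γ : ℝ) (H h : ℕ) (s : S) (a : A) (s' : S) :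
    Measurable fun ω => ProST.errorStep (F ω) (F' ω) γ H (π ω) h s a s' :=
  ((hF.backup (hF'.stepValue hπ γ H (h + 1)) γ s a).sub
    (hF'.backup (hF'.stepValue hπ γ H (h + 1)) γ s a)).sub
    ((hF.valueError hF' hπ γ H (h + 1) s').const_mul γ)

end Measurability

lemma integrable_cosh {Ω : Type*} [MeasurableSpace Ω] {μ : Measure Ω} [IsFiniteMeasure μ]
    {z : Ω → ℝ} (hz : Measurable z) {B : ℝ} (hB : ∀ ω, |z ω| ≤ B) (l : ℝ) :
    Integrable (fun ω => Real.cosh (l * z ω)) μ := by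
  refine Integrable.of_bound (Real.continuous_cosh.measurable.comp
    (hz.const_mul l)).aestronglyMeasurable (Real.cosh (l * B)) (Filter.Eventually.of_forall
    fun ω => ?_)
  rw [Real.norm_of_nonneg (Real.cosh_pos _).le, Real.cosh_le_cosh, abs_mul, abs_mul]
  exact mul_le_mul_of_nonneg_left ((hB ω).trans (le_abs_self B)) (abs_nonneg l)

namespace Interaction

variable {S A Ω : Type*} [Fintype S] [Fintype A] [MeasurableSpace Ω] {μ : Measure Ω}
  {env : ℕ → Model S A} {K H : ℕ} {s₀ : S} (X : Interaction μ env K H s₀)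

lemma ℱ_mono {k n k' n' : ℕ} (h : k < k' ∨ k = k' ∧ n ≤ n') :
    X.ℱ (toLex (k, n)) ≤ X.ℱ (toLex (k', n')) :=
  X.ℱ.mono (Prod.Lex.le_iff.2 h)

/-- Expand over the finitely many pairs of action and next state, pull the factor known at step `h`
out of the conditional expectation, and insert the law. -/
lemma integral_action_state [IsFiniteMeasure μ] {k h : ℕ} (hk : 1 ≤ k) (hkK : k ≤ K) (hh : h < H)
    {G : A → S → Ω → ℝ} (hG : ∀ a s', Measurable[X.ℱ (toLex (k, h))] (G a s'))
    (hi : ∀ a s', Integrable (G a s') μ) :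
    Integrable (fun ω => ∑ a, ∑ s', (X.policy k ω (X.state k h ω)).1 a *
        (env k).P (X.state k h ω) a s' * G a s' ω) μ ∧
    ∫ ω, G (X.action k h ω) (X.state k (h + 1) ω) ω ∂μ =
      ∫ ω, ∑ a, ∑ s', (X.policy k ω (X.state k h ω)).1 a *
        (env k).P (X.state k h ω) a s' * G a s' ω ∂μ := by
  classical
  set I : A → S → Ω → ℝ := fun a s' => Set.indicator
    {ω | X.action k h ω = a ∧ X.state k (h + 1) ω = s'} (fun _ => (1 : ℝ)) with hI
  have hset : ∀ a s', MeasurableSet {ω | X.action k h ω = a ∧ X.state k (h + 1) ω = s'} :=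
    fun a s' => X.ℱ.le _ _ ((X.measurable_action k h a).inter (X.measurable_state k (h + 1) s'))
  have hIG : ∀ a s', Integrable (I a s' * G a s') μ := by
    intro a s'
    have : I a s' * G a s' =
        Set.indicator {ω | X.action k h ω = a ∧ X.state k (h + 1) ω = s'} (G a s') := by
      funext ω
      simp only [hI, Pi.mul_apply, Set.indicator_apply]
      split_ifs <;> simp
    rw [this]
    exact (hi a s').indicator (hset a s')
  have hae : ∀ a s', μ[I a s' * G a s' | X.ℱ (toLex (k, h))] =ᵐ[μ] fun ω =>
      (X.policy k ω (X.state k h ω)).1 a * (env k).P (X.state k h ω) a s' * G a s' ω := by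
    intro a s'
    have h1 := condExp_mul_of_stronglyMeasurable_right (μ := μ) (hG a s').stronglyMeasurable
      (hIG a s') ((integrable_const (1 : ℝ)).indicator (hset a s'))
    filter_upwards [h1, X.law k h hk hkK hh a s'] with ω h2 h3
    rw [h2, Pi.mul_apply, h3]
  -- Integrability is inherited from the conditional expectation.
  have hint : ∀ a s', Integrable (fun ω => (X.policy k ω (X.state k h ω)).1 a *
      (env k).P (X.state k h ω) a s' * G a s' ω) μ := fun a s' =>
    integrable_condExp.congr (hae a s')
  have hsel : ∀ ω, G (X.action k h ω) (X.state k (h + 1) ω) ω =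
      ∑ a, ∑ s', (I a s' * G a s') ω := by
    intro ω
    rw [Finset.sum_eq_single (X.action k h ω), Finset.sum_eq_single (X.state k (h + 1) ω)]
    · simp [hI]
    · intro s' _ hs'
      simp [hI, Ne.symm hs']
    · simp
    · intro a _ ha
      simp [hI, Ne.symm ha]
    · simp
  refine ⟨integrable_finsetSum _ fun a _ => integrable_finsetSum _ fun s' _ => hint a s', ?_⟩
  simp only [hsel]
  rw [integral_finsetSum _ fun a _ => integrable_finsetSum _ fun s' _ => hIG a s',
    integral_finsetSum _ fun a _ => integrable_finsetSum _ fun s' _ => hint a s']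
  refine Finset.sum_congr rfl fun a _ => ?_
  rw [integral_finsetSum _ fun s' _ => hIG a s', integral_finsetSum _ fun s' _ => hint a s']
  refine Finset.sum_congr rfl fun s' _ => ?_
  rw [← integral_condExp (X.ℱ.le (toLex (k, h))), integral_congr_ae (hae a s')]

/-- One step of the exponential supermartingale. -/
lemma integral_cosh_step [IsFiniteMeasure μ] {k h : ℕ} (hk : 1 ≤ k) (hkK : k ≤ K) (hh : h < H)
    (henv : (env k).IsMDP) {z w : Ω → ℝ} {g : A → S → Ω → ℝ}
    (hz : Measurable[X.ℱ (toLex (k, h))] z) (hw : Measurable[X.ℱ (toLex (k, h))] w)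
    (hg : ∀ a s', Measurable[X.ℱ (toLex (k, h))] (g a s')) {B b : ℝ} (hzB : ∀ ω, |z ω| ≤ B)
    (hgb : ∀ a s' ω, |g a s' ω| ≤ b)
    (hmean : ∀ ω, ∑ a, ∑ s', (X.policy k ω (X.state k h ω)).1 a *
      (env k).P (X.state k h ω) a s' * g a s' ω = w ω) (l : ℝ) :
    ∫ ω, Real.cosh (l * (z ω + (g (X.action k h ω) (X.state k (h + 1) ω) ω - w ω))) ∂μ ≤
      Real.exp (l ^ 2 * b ^ 2 / 2) * ∫ ω, Real.cosh (l * z ω) ∂μ := by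
  have hp : ∀ ω, ∀ i : A × S, 0 ≤ (X.policy k ω (X.state k h ω)).1 i.1 *
      (env k).P (X.state k h ω) i.1 i.2 := fun ω i =>
    mul_nonneg ((X.policy k ω (X.state k h ω)).2.1 i.1) (henv.1 _ _ _)
  have hp₁ : ∀ ω, ∑ i : A × S, (X.policy k ω (X.state k h ω)).1 i.1 *
      (env k).P (X.state k h ω) i.1 i.2 = 1 := by
    intro ω
    rw [Fintype.sum_prod_type]
    simp only [← Finset.mul_sum, henv.2, mul_one]
    exact (X.policy k ω (X.state k h ω)).2.2
  have hw' : ∀ ω, ∑ i : A × S, (X.policy k ω (X.state k h ω)).1 i.1 *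
      (env k).P (X.state k h ω) i.1 i.2 * g i.1 i.2 ω = w ω := by
    intro ω
    rw [Fintype.sum_prod_type]
    exact hmean ω
  have hwb : ∀ ω, |w ω| ≤ b := by
    intro ω
    rw [← hw' ω]
    exact abs_avg_le ⟨_, hp ω, hp₁ ω⟩ (fun i : A × S => hgb i.1 i.2 ω)
  have hGm : ∀ a s', Measurable[X.ℱ (toLex (k, h))] fun ω => z ω + (g a s' ω - w ω) :=
    fun a s' => hz.add ((hg a s').sub hw)
  have hGb : ∀ a s' ω, |z ω + (g a s' ω - w ω)| ≤ B + (b + b) := fun a s' ω =>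
    (abs_add_le _ _).trans (add_le_add (hzB ω) ((abs_sub _ _).trans
      (add_le_add (hgb a s' ω) (hwb ω))))
  obtain ⟨hi, he⟩ := X.integral_action_state hk hkK hh
    (G := fun a s' ω => Real.cosh (l * (z ω + (g a s' ω - w ω))))
    (fun a s' => Real.continuous_cosh.measurable.comp ((hGm a s').const_mul l))
    (fun a s' => integrable_cosh ((hGm a s').mono (X.ℱ.le _) le_rfl) (hGb a s') l)
  rw [he, ← integral_const_mul]
  refine integral_mono hi ((integrable_cosh (hz.mono (X.ℱ.le _) le_rfl) hzB l).const_mul _)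
    fun ω => ?_
  have := hoeffding_cosh (hp ω) (hp₁ ω) (fun i : A × S => hgb i.1 i.2 ω) (hw' ω) l (z ω)
  rw [Fintype.sum_prod_type] at this
  exact this

end Interaction

end ProST

/-! ### The martingale and its concentration relative to a random scale. -/

namespace ProST

lemma measurableModel_const {S A Ω : Type*} (m : MeasurableSpace Ω) (M : Model S A) :
    @MeasurableModel _ _ _ m fun _ : Ω => M :=
  @MeasurableModel.mk _ _ _ m _ (fun _ _ _ => measurable_const) (fun _ _ => measurable_const)

lemma MeasurableModel.norm_R {S A Ω : Type*} [MeasurableSpace Ω] [Fintype S] [Fintype A]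
    {F : Ω → Model S A} (hF : MeasurableModel F) : Measurable fun ω => ‖(F ω).R‖ :=
  Measurable.norm (measurable_pi_lambda _ fun s => measurable_pi_lambda _ fun a => hF.R s a)

namespace Interaction

variable {S A Ω : Type*} [Fintype S] [Fintype A] [MeasurableSpace Ω] {μ : Measure Ω}
  {env : ℕ → Model S A} {K H : ℕ} {s₀ : S} (X : Interaction μ env K H s₀)

/-- Increment of the martingale at step `h` of episode `k`. -/
noncomputable def noiseStep (γ : ℝ) (k h : ℕ) (ω : Ω) : ℝ :=
  errorStep (env k) (X.forecast k ω) γ H (X.policy k ω) h (X.state k h ω) (X.action k h ω)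
    (X.state k (h + 1) ω) +
  valueError (env k) (X.forecast k ω) γ H (X.policy k ω) h (X.state k h ω)

/-- Martingale of the first `n` steps of episode `k`. -/
noncomputable def noise (γ : ℝ) (k n : ℕ) (ω : Ω) : ℝ :=
  ∑ h ∈ Finset.range n, γ ^ h * X.noiseStep γ k h ω

/-- Martingale of the episodes `2, …, n + 1`. -/
noncomputable def totalNoise (γ : ℝ) (n : ℕ) (ω : Ω) : ℝ :=
  ∑ j ∈ Finset.range n, X.noise γ (j + 2) H ω

/-- Largest reward forecasted for the episodes `2, …, n + 1`, and at least `r₀`. -/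
noncomputable def scale (r₀ : ℝ) : ℕ → Ω → ℝ
  | 0, _ => r₀
  | n + 1, ω => max (scale r₀ n ω) ‖(X.forecast (n + 2) ω).R‖

/-- Bound of the increments relative to the scale. -/
noncomputable def stepBound (γ : ℝ) (H h : ℕ) : ℝ :=
  γ ^ h * (2 + 4 * γ * ∑ i ∈ Finset.range (H - (h + 1)), γ ^ i)

lemma stepBound_nonneg {γ : ℝ} (hγ₀ : 0 ≤ γ) (H h : ℕ) : 0 ≤ stepBound γ H h := by
  unfold stepBound; positivity

lemma scale_mono (r₀ : ℝ) (n : ℕ) (ω : Ω) : X.scale r₀ n ω ≤ X.scale r₀ (n + 1) ω :=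
  le_max_left _ _

lemma le_scale (r₀ : ℝ) (n : ℕ) (ω : Ω) : r₀ ≤ X.scale r₀ n ω := by
  induction n with
  | zero => exact le_rfl
  | succ n ih => exact ih.trans (X.scale_mono r₀ n ω)

lemma measurableModel_forecast (k h : ℕ) :
    @MeasurableModel _ _ _ (X.ℱ (toLex (k, h))) (X.forecast k) :=
  @MeasurableModel.mk _ _ _ (X.ℱ (toLex (k, h))) _
    (fun s a s' => (X.measurable_forecast_P k s a s').mono (X.ℱ_mono (.inr ⟨rfl, h.zero_le⟩))
      le_rfl)
    (fun s a => (X.measurable_forecast_R k s a).mono (X.ℱ_mono (.inr ⟨rfl, h.zero_le⟩)) le_rfl)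

lemma measurable_policy' (k h : ℕ) (s : S) (a : A) :
    Measurable[X.ℱ (toLex (k, h))] fun ω => (X.policy k ω s).1 a :=
  (X.measurable_policy k s a).mono (X.ℱ_mono (.inr ⟨rfl, h.zero_le⟩)) le_rfl

lemma measurable_valueError (γ : ℝ) (k h : ℕ) :
    Measurable[X.ℱ (toLex (k, h))] fun ω => valueError (env k) (X.forecast k ω) γ H
      (X.policy k ω) h (X.state k h ω) :=
  @measurable_select _ _ (X.ℱ (toLex (k, h))) _ _ (X.measurable_state k h)
    (fun s ω => valueError (env k) (X.forecast k ω) γ H (X.policy k ω) h s)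
    fun s => @MeasurableModel.valueError _ _ _ (X.ℱ (toLex (k, h))) _ _ _ _ _
      (measurableModel_const _ (env k)) (X.measurableModel_forecast k h) (X.measurable_policy' k h) γ H h s

lemma measurable_errorStep (γ : ℝ) (k h n : ℕ) (hn : h ≤ n) (a : A) (s' : S) :
    Measurable[X.ℱ (toLex (k, n))] fun ω => errorStep (env k) (X.forecast k ω) γ H
      (X.policy k ω) h (X.state k h ω) a s' :=
  (@measurable_select _ _ (X.ℱ (toLex (k, h))) _ _ (X.measurable_state k h)
    (fun s ω => errorStep (env k) (X.forecast k ω) γ H (X.policy k ω) h s a s')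
    fun s => @MeasurableModel.errorStep _ _ _ (X.ℱ (toLex (k, h))) _ _ _ _ _
      (measurableModel_const _ (env k)) (X.measurableModel_forecast k h) (X.measurable_policy' k h)
      γ H h s a s').mono (X.ℱ_mono (.inr ⟨rfl, hn⟩)) le_rfl

lemma measurable_noiseStep (γ : ℝ) (k h : ℕ) :
    Measurable[X.ℱ (toLex (k, h + 1))] (X.noiseStep γ k h) := by
  refine Measurable.add ?_ ((X.measurable_valueError γ k h).mono
    (X.ℱ_mono (.inr ⟨rfl, h.le_succ⟩)) le_rfl)
  exact @measurable_select _ _ (X.ℱ (toLex (k, h + 1))) _ _ (X.measurable_action k h)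
    (fun a ω => errorStep (env k) (X.forecast k ω) γ H (X.policy k ω) h (X.state k h ω) a
      (X.state k (h + 1) ω)) fun a =>
    @measurable_select _ _ (X.ℱ (toLex (k, h + 1))) _ _ (X.measurable_state k (h + 1))
      (fun s' ω => errorStep (env k) (X.forecast k ω) γ H (X.policy k ω) h (X.state k h ω) a s')
      fun s' => X.measurable_errorStep γ k h (h + 1) h.le_succ a s'

lemma measurable_noise (γ : ℝ) (k n : ℕ) : Measurable[X.ℱ (toLex (k, n))] (X.noise γ k n) :=
  Finset.measurable_sum _ fun h hh => ((X.measurable_noiseStep γ k h).const_mul _).mono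
    (X.ℱ_mono (.inr ⟨rfl, Finset.mem_range.1 hh⟩)) le_rfl

lemma measurable_totalNoise (γ : ℝ) (n h : ℕ) :
    Measurable[X.ℱ (toLex (n + 2, h))] (X.totalNoise γ n) :=
  Finset.measurable_sum _ fun j hj => (X.measurable_noise γ (j + 2) H).mono
    (X.ℱ_mono (.inl (by have := Finset.mem_range.1 hj; lia))) le_rfl

/-- Predictability: the scale that includes the forecast for episode `n + 2` is known when that
episode starts, so it can be treated as constant throughout the episode. -/
lemma measurable_scale (r₀ : ℝ) (n h : ℕ) :
    Measurable[X.ℱ (toLex (n + 1, h))] (X.scale r₀ n) := by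
  induction n generalizing h with
  | zero => exact measurable_const
  | succ n ih =>
    exact Measurable.max ((ih 0).mono (X.ℱ_mono (.inl (by lia))) le_rfl)
      (@MeasurableModel.norm_R _ _ _ (X.ℱ (toLex (n + 2, h))) _ _ _
        (X.measurableModel_forecast (n + 2) h))

lemma abs_errorStep_le_scale {γ r₀ : ℝ} (hγ₀ : 0 ≤ γ) {n : ℕ} (henv : (env (n + 2)).IsMDP)
    (hr₀ : ‖(env (n + 2)).R‖ ≤ r₀) (h : ℕ) (π : Policy S A) (s : S) (a : A) (s' : S) (ω : Ω) :
    |γ ^ h * errorStep (env (n + 2)) (X.forecast (n + 2) ω) γ H π h s a s'| ≤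
      X.scale r₀ (n + 1) ω * stepBound γ H h := by
  have := abs_errorStep_le (H := H) (h := h) henv.isSubMDP (X.isSubMDP_forecast (n + 2) ω) hγ₀
    (r := X.scale r₀ (n + 1) ω)
    (fun s a => (abs_apply_le_norm _ s a).trans (hr₀.trans (X.le_scale r₀ _ ω)))
    (fun s a => (abs_apply_le_norm _ s a).trans (le_max_right _ _)) π s a s'
  rw [abs_mul, abs_of_nonneg (pow_nonneg hγ₀ h), stepBound, mul_left_comm]
  exact mul_le_mul_of_nonneg_left this (pow_nonneg hγ₀ h)

lemma avg_errorStep_eq {γ : ℝ} {k h : ℕ} (henv : (env k).IsMDP) (hh : h < H) (c : ℝ) (ω : Ω) :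
    ∑ a, ∑ s', (X.policy k ω (X.state k h ω)).1 a * (env k).P (X.state k h ω) a s' *
      (c * errorStep (env k) (X.forecast k ω) γ H (X.policy k ω) h (X.state k h ω) a s') =
    -(c * valueError (env k) (X.forecast k ω) γ H (X.policy k ω) h (X.state k h ω)) := by
  rw [← mul_neg, ← avg_errorStep henv γ hh, Finset.mul_sum]
  refine Finset.sum_congr rfl fun a _ => ?_
  rw [Finset.mul_sum]
  exact Finset.sum_congr rfl fun s' _ => by ring

/-- This cruder bound, twice the step bound, serves integrability and the case of scale zero; the
concentration constant uses the uncentered bound. -/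
lemma abs_noiseStep_le {γ r₀ : ℝ} (hγ₀ : 0 ≤ γ) {n : ℕ} (henv : (env (n + 2)).IsMDP)
    (hr₀ : ‖(env (n + 2)).R‖ ≤ r₀) {h : ℕ} (hh : h < H) (ω : Ω) :
    |γ ^ h * X.noiseStep γ (n + 2) h ω| ≤ X.scale r₀ (n + 1) ω * (2 * stepBound γ H h) := by
  have h1 := fun a s' => X.abs_errorStep_le_scale hγ₀ henv hr₀ h (X.policy (n + 2) ω)
    (X.state (n + 2) h ω) a s' ω
  have h2 := X.avg_errorStep_eq (γ := γ) henv hh (γ ^ h) ω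
  have h3 : |γ ^ h * valueError (env (n + 2)) (X.forecast (n + 2) ω) γ H (X.policy (n + 2) ω) h
      (X.state (n + 2) h ω)| ≤ X.scale r₀ (n + 1) ω * stepBound γ H h := by
    rw [← abs_neg, ← h2]
    simp only [mul_assoc, ← Finset.mul_sum]
    exact abs_avg_le _ fun a => abs_avg_le ⟨_, henv.1 _ _, henv.2 _ _⟩ fun s' => h1 a s'
  rw [noiseStep, mul_add]
  refine (abs_add_le _ _).trans ((add_le_add (h1 _ _) h3).trans_eq ?_)
  ring

lemma abs_noise_le {γ r₀ : ℝ} (hγ₀ : 0 ≤ γ) {n : ℕ} (henv : (env (n + 2)).IsMDP)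
    (hr₀ : ‖(env (n + 2)).R‖ ≤ r₀) {m : ℕ} (hm : m ≤ H) (ω : Ω) :
    |X.noise γ (n + 2) m ω| ≤
      X.scale r₀ (n + 1) ω * ∑ h ∈ Finset.range m, 2 * stepBound γ H h := by
  rw [noise, Finset.mul_sum]
  exact (Finset.abs_sum_le_sum_abs _ _).trans (Finset.sum_le_sum fun h hh =>
    X.abs_noiseStep_le hγ₀ henv hr₀ ((Finset.mem_range.1 hh).trans_le hm) ω)

lemma abs_totalNoise_le {γ r₀ : ℝ} (hγ₀ : 0 ≤ γ)
    (henv : ∀ k, 1 ≤ k → k ≤ K → (env k).IsMDP) (hr₀ : ∀ k, 2 ≤ k → k ≤ K → ‖(env k).R‖ ≤ r₀)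
    {n : ℕ} (hn : n + 1 ≤ K) (ω : Ω) :
    |X.totalNoise γ n ω| ≤
      X.scale r₀ n ω * (n * ∑ h ∈ Finset.range H, 2 * stepBound γ H h) := by
  have hb : 0 ≤ ∑ h ∈ Finset.range H, 2 * stepBound γ H h :=
    Finset.sum_nonneg fun h _ => mul_nonneg zero_le_two (stepBound_nonneg hγ₀ H h)
  induction n with
  | zero => simp [totalNoise]
  | succ n ih =>
    rw [totalNoise, Finset.sum_range_succ]
    have h1 := X.abs_noise_le hγ₀ (henv (n + 2) (by lia) hn) (hr₀ (n + 2) (by lia) hn) le_rfl ω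
    have h2 := (ih (by lia)).trans (mul_le_mul_of_nonneg_right (X.scale_mono r₀ n ω)
      (by positivity))
    refine (abs_add_le _ _).trans ((add_le_add h2 h1).trans_eq ?_)
    push_cast
    ring

lemma abs_div_le_of_abs_le_mul {x y c : ℝ} (hy : 0 ≤ y) (hc : 0 ≤ c) (h : |x| ≤ y * c) :
    |x / y| ≤ c := by
  rw [abs_div, abs_of_nonneg hy]
  exact div_le_of_le_mul₀ hy hc (by linarith)

/-- Dividing the martingale by the running scale, which is random but predictable, gives an
exponential supermartingale, since `cosh` decreases when the scale grows. -/
lemma integral_cosh_totalNoise_le [IsProbabilityMeasure μ] {γ r₀ : ℝ} (hγ₀ : 0 ≤ γ)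
    (henv : ∀ k, 1 ≤ k → k ≤ K → (env k).IsMDP) (hr₀' : 0 ≤ r₀)
    (hr₀ : ∀ k, 2 ≤ k → k ≤ K → ‖(env k).R‖ ≤ r₀) (l : ℝ) {n : ℕ} (hn : n + 1 ≤ K) :
    ∫ ω, Real.cosh (l * (X.totalNoise γ n ω / X.scale r₀ n ω)) ∂μ ≤
      Real.exp (l ^ 2 * (n * ∑ h ∈ Finset.range H, stepBound γ H h ^ 2) / 2) := by
  have hsc : ∀ n ω, 0 ≤ X.scale r₀ n ω := fun n ω => hr₀'.trans (X.le_scale r₀ n ω)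
  have hsum : ∀ m, 0 ≤ ∑ h ∈ Finset.range m, 2 * stepBound γ H h := fun m =>
    Finset.sum_nonneg fun h _ => mul_nonneg zero_le_two (stepBound_nonneg hγ₀ H h)
  induction n with
  | zero => simp [totalNoise]
  | succ n ih =>
    have henv' := henv (n + 2) (by lia) hn
    have hr' := hr₀ (n + 2) (by lia) hn
    have hT : ∀ ω, |X.totalNoise γ n ω| ≤ X.scale r₀ n ω *
        (n * ∑ h ∈ Finset.range H, 2 * stepBound γ H h) := fun ω =>
      X.abs_totalNoise_le hγ₀ henv hr₀ (by lia) ω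
    have hc₀ : 0 ≤ n * ∑ h ∈ Finset.range H, 2 * stepBound γ H h :=
      mul_nonneg n.cast_nonneg (hsum H)
    have hT' : ∀ ω, |X.totalNoise γ n ω| ≤ X.scale r₀ (n + 1) ω *
        (n * ∑ h ∈ Finset.range H, 2 * stepBound γ H h) := fun ω =>
      (hT ω).trans (mul_le_mul_of_nonneg_right (X.scale_mono r₀ n ω) hc₀)
    -- Between episodes the denominator is enlarged first, while the numerator stays the same.
    have hgrow : ∫ ω, Real.cosh (l * (X.totalNoise γ n ω / X.scale r₀ (n + 1) ω)) ∂μ ≤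
        ∫ ω, Real.cosh (l * (X.totalNoise γ n ω / X.scale r₀ n ω)) ∂μ := by
      have hm : ∀ i, Measurable fun ω => X.totalNoise γ n ω / X.scale r₀ i ω := fun i =>
        ((X.measurable_totalNoise γ n 0).mono (X.ℱ.le _) le_rfl).div
          ((X.measurable_scale r₀ i 0).mono (X.ℱ.le _) le_rfl)
      refine integral_mono
        (integrable_cosh (hm _)
          (fun ω => abs_div_le_of_abs_le_mul (hsc _ ω) hc₀ (hT' ω)) l)
        (integrable_cosh (hm _)
          (fun ω => abs_div_le_of_abs_le_mul (hsc _ ω) hc₀ (hT ω)) l) fun ω => ?_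
      rw [Real.cosh_le_cosh, abs_mul, abs_mul]
      refine mul_le_mul_of_nonneg_left ?_ (abs_nonneg l)
      -- If the old scale is zero, so is the numerator, and the convention `x / 0 = 0` does no harm.
      rcases (hsc n ω).eq_or_lt with h0 | h0
      · have : X.totalNoise γ n ω = 0 := by
          have := hT ω
          rw [← h0, zero_mul] at this
          exact abs_nonpos_iff.1 this
        simp [this]
      · rw [abs_div, abs_div, abs_of_pos h0, abs_of_nonneg (hsc (n + 1) ω)]
        exact div_le_div_of_nonneg_left (abs_nonneg _) h0 (X.scale_mono r₀ n ω)
    have hstep : ∀ m ≤ H, ∫ ω, Real.cosh (l * ((X.totalNoise γ n ω + X.noise γ (n + 2) m ω) /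
        X.scale r₀ (n + 1) ω)) ∂μ ≤ Real.exp (l ^ 2 *
          (n * ∑ h ∈ Finset.range H, stepBound γ H h ^ 2 +
            ∑ h ∈ Finset.range m, stepBound γ H h ^ 2) / 2) := by
      intro m
      induction m with
      | zero =>
        intro _
        simp only [noise, Finset.range_zero, Finset.sum_empty, add_zero]
        exact hgrow.trans (ih (by lia))
      | succ m ihm =>
        intro hm
        have hms : Measurable[X.ℱ (toLex (n + 2, m))] (X.scale r₀ (n + 1)) :=
          X.measurable_scale r₀ (n + 1) m
        have hb : ∀ ω, |X.totalNoise γ n ω + X.noise γ (n + 2) m ω| ≤ X.scale r₀ (n + 1) ω *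
            (n * ∑ h ∈ Finset.range H, 2 * stepBound γ H h +
              ∑ h ∈ Finset.range m, 2 * stepBound γ H h) := by
          intro ω
          rw [mul_add]
          exact (abs_add_le _ _).trans (add_le_add (hT' ω)
            (X.abs_noise_le hγ₀ henv' hr' (by lia) ω))
        have h1 := X.integral_cosh_step (k := n + 2) (h := m) (by lia) hn hm henv'
          (z := fun ω => (X.totalNoise γ n ω + X.noise γ (n + 2) m ω) / X.scale r₀ (n + 1) ω)
          (w := fun ω => -(γ ^ m / X.scale r₀ (n + 1) ω * valueError (env (n + 2))
            (X.forecast (n + 2) ω) γ H (X.policy (n + 2) ω) m (X.state (n + 2) m ω)))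
          (g := fun a s' ω => γ ^ m / X.scale r₀ (n + 1) ω * errorStep (env (n + 2))
            (X.forecast (n + 2) ω) γ H (X.policy (n + 2) ω) m (X.state (n + 2) m ω) a s')
          (((X.measurable_totalNoise γ n m).add (X.measurable_noise γ (n + 2) m)).div hms)
          (((measurable_const.div hms).mul (X.measurable_valueError γ (n + 2) m)).neg)
          (fun a s' => (measurable_const.div hms).mul
            (X.measurable_errorStep γ (n + 2) m m le_rfl a s'))
          (fun ω => abs_div_le_of_abs_le_mul (hsc _ ω) (add_nonneg hc₀ (hsum m)) (hb ω))
          (b := stepBound γ H m)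
          (fun a s' ω => by
            rw [div_mul_eq_mul_div]
            exact abs_div_le_of_abs_le_mul (hsc _ ω) (stepBound_nonneg hγ₀ H m)
              (X.abs_errorStep_le_scale hγ₀ henv' hr' m _ _ a s' ω))
          (fun ω => X.avg_errorStep_eq henv' hm _ ω) l
        have h2 : ∀ ω, (X.totalNoise γ n ω + X.noise γ (n + 2) (m + 1) ω) /
            X.scale r₀ (n + 1) ω =
            (X.totalNoise γ n ω + X.noise γ (n + 2) m ω) / X.scale r₀ (n + 1) ω +
            (γ ^ m / X.scale r₀ (n + 1) ω * errorStep (env (n + 2)) (X.forecast (n + 2) ω) γ H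
              (X.policy (n + 2) ω) m (X.state (n + 2) m ω) (X.action (n + 2) m ω)
              (X.state (n + 2) (m + 1) ω) - -(γ ^ m / X.scale r₀ (n + 1) ω *
              valueError (env (n + 2)) (X.forecast (n + 2) ω) γ H (X.policy (n + 2) ω) m
                (X.state (n + 2) m ω))) := by
          intro ω
          rw [noise, Finset.sum_range_succ, ← noise, noiseStep]
          ring
        simp only [h2]
        refine h1.trans ((mul_le_mul_of_nonneg_left (ihm (by lia))
          (Real.exp_pos _).le).trans_eq ?_)
        rw [← Real.exp_add, Finset.sum_range_succ]
        congr 1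
        ring
    have h3 := hstep H le_rfl
    have h4 : ∀ ω, X.totalNoise γ (n + 1) ω = X.totalNoise γ n ω + X.noise γ (n + 2) H ω :=
      fun ω => Finset.sum_range_succ _ _
    simp only [h4]
    refine h3.trans_eq ?_
    congr 1
    push_cast
    ring

/-- Azuma–Hoeffding inequality relative to the random scale of the rewards. -/
lemma measure_totalNoise_gt_le [IsProbabilityMeasure μ] {γ r₀ p : ℝ} (hγ₀ : 0 ≤ γ) (hγ₁ : γ < 1)
    (hp₀ : 0 < p) (hp₁ : p < 1) (henv : ∀ k, 1 ≤ k → k ≤ K → (env k).IsMDP) (hr₀' : 0 ≤ r₀)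
    (hr₀ : ∀ k, 2 ≤ k → k ≤ K → ‖(env k).R‖ ≤ r₀) {n : ℕ} (hn : n + 1 ≤ K) :
    μ {ω | 4 * X.scale r₀ n ω / (1 - γ) * √(H * Real.log (4 / p)) * √n < X.totalNoise γ n ω} ≤
      ENNReal.ofReal (p / 2) := by
  have hγ' : 0 < 1 - γ := by linarith
  have hL : 0 < Real.log (4 / p) := Real.log_pos (by rw [lt_div_iff₀ hp₀]; linarith)
  have hsc : ∀ ω, 0 ≤ X.scale r₀ n ω := fun ω => hr₀'.trans (X.le_scale r₀ n ω)
  have hT := X.abs_totalNoise_le hγ₀ henv hr₀ hn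
  set V : ℝ := n * (8 * H / (1 - γ) ^ 2) with hV
  set x : ℝ := 4 / (1 - γ) * √(H * Real.log (4 / p)) * √n with hx
  have hx₀ : 0 ≤ x := by positivity
  have hx2 : x ^ 2 = 2 * V * Real.log (4 / p) := by
    rw [hx, mul_pow, mul_pow, Real.sq_sqrt (by positivity), Real.sq_sqrt (by positivity), hV]
    field_simp
    ring
  have hthr : ∀ ω, 4 * X.scale r₀ n ω / (1 - γ) * √(H * Real.log (4 / p)) * √n =
      x * X.scale r₀ n ω := fun ω => by rw [hx]; ring
  simp only [hthr]
  -- If `V = 0` there are no steps and no noise; otherwise division by `V` makes sense.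
  rcases (show 0 ≤ V by positivity).eq_or_lt with hV0 | hV0
  · have h0 : (n : ℝ) = 0 ∨ H = 0 := by
      rw [eq_comm, hV] at hV0
      rcases mul_eq_zero.1 hV0 with h | h
      · exact .inl h
      · right
        have := (div_eq_zero_iff.1 h).resolve_right (by positivity)
        exact_mod_cast (mul_eq_zero.1 this).resolve_left (by norm_num)
    have hT0 : ∀ ω, X.totalNoise γ n ω = 0 := by
      intro ω
      rw [← abs_nonpos_iff]
      refine (hT ω).trans_eq ?_
      rcases h0 with h | h
      · simp [h]
      · subst h; simp
    have : {ω | x * X.scale r₀ n ω < X.totalNoise γ n ω} = ∅ := by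
      ext ω
      simp only [hT0, Set.mem_ofPred_eq, Set.mem_empty_iff_false, iff_false, not_lt]
      exact mul_nonneg hx₀ (hsc ω)
    rw [this]; simp
  -- This `l` minimizes `l² V / 2 - l x`. With `x² = 2 V log(4/p)` the minimum is `-log(4/p)`, and
  -- the factor `2` lost in `cosh ≥ exp / 2` turns `p/4` into `p/2`.
  · set l := x / V with hl
    have hl₀ : 0 ≤ l := div_nonneg hx₀ hV0.le
    set f : Ω → ℝ := fun ω => Real.cosh (l * (X.totalNoise γ n ω / X.scale r₀ n ω)) with hf
    have hsub : {ω | x * X.scale r₀ n ω < X.totalNoise γ n ω} ⊆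
        {ω | Real.cosh (l * x) ≤ f ω} := by
      intro ω hω
      simp only [Set.mem_ofPred_eq] at hω ⊢
      -- At scale zero the noise vanishes, which contradicts the strict inequality.
      have hs : 0 < X.scale r₀ n ω := by
        rcases (hsc ω).eq_or_lt with h | h
        · have h1 := hT ω
          rw [← h, zero_mul] at h1
          rw [← h, mul_zero, abs_nonpos_iff.1 h1] at hω
          exact absurd hω (lt_irrefl _)
        · exact h
      rw [hf, Real.cosh_le_cosh, abs_of_nonneg (mul_nonneg hl₀ hx₀)]
      exact (mul_le_mul_of_nonneg_left ((le_div_iff₀ hs).2 hω.le) hl₀).trans (le_abs_self _)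
    have hfi : Integrable f μ := integrable_cosh
      (((X.measurable_totalNoise γ n 0).mono (X.ℱ.le _) le_rfl).div
        ((X.measurable_scale r₀ n 0).mono (X.ℱ.le _) le_rfl))
      (fun ω => abs_div_le_of_abs_le_mul (hsc ω) (mul_nonneg n.cast_nonneg
        (Finset.sum_nonneg fun h _ => mul_nonneg zero_le_two (stepBound_nonneg hγ₀ H h))) (hT ω)) l
    have hmarkov := mul_meas_ge_le_integral_of_nonneg
      (Filter.Eventually.of_forall fun ω => (Real.cosh_pos _).le) hfi (Real.cosh (l * x))
    have hint := X.integral_cosh_totalNoise_le hγ₀ henv hr₀' hr₀ l hn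
    have hexp : Real.exp (l ^ 2 * (n * ∑ h ∈ Finset.range H, stepBound γ H h ^ 2) / 2) ≤
        Real.exp (l ^ 2 * V / 2) := by
      refine Real.exp_le_exp.2 (div_le_div_of_nonneg_right (mul_le_mul_of_nonneg_left
        (mul_le_mul_of_nonneg_left ?_ n.cast_nonneg) (sq_nonneg l)) zero_le_two)
      exact sum_sq_errorStep_bound_le hγ₀ hγ₁ H
    have hcosh : Real.exp (l * x) / 2 ≤ Real.cosh (l * x) := by
      rw [Real.cosh_eq]
      have := Real.exp_pos (-(l * x))
      linarith
    have hkey : Real.exp (l ^ 2 * V / 2) = p / 4 * Real.exp (l * x) := by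
      have h1 : p / 4 = Real.exp (-Real.log (4 / p)) := by
        rw [← Real.log_inv, Real.exp_log (by positivity), inv_div]
      rw [h1, ← Real.exp_add]
      congr 1
      have h2 : l * x = 2 * Real.log (4 / p) := by
        rw [hl, div_mul_eq_mul_div, ← sq, hx2]
        field_simp
      have h3 : l ^ 2 * V = l * x := by
        rw [hl]
        field_simp
      rw [h3, h2]
      ring
    have hreal : μ.real {ω | Real.cosh (l * x) ≤ f ω} ≤ p / 2 := by
      refine le_of_mul_le_mul_left ?_ (Real.cosh_pos (l * x))
      have := mul_le_mul_of_nonneg_left hcosh hp₀.le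
      linarith
    refine (measure_mono hsub).trans ?_
    rw [← ofReal_measureReal]
    exact ENNReal.ofReal_le_ofReal hreal

end Interaction

end ProST

/-! ### From the episodes to the regret bound. -/

namespace ProST

namespace Interaction

variable {S A Ω : Type*} [Fintype S] [Fintype A] [MeasurableSpace Ω] {μ : Measure Ω}
  {env : ℕ → Model S A} {K H : ℕ} {s₀ : S} (X : Interaction μ env K H s₀)

lemma le_iSup_episodes (f : ℕ → ℝ) {k : ℕ} (hk : k ∈ Finset.Ico 1 K) :
    f k ≤ ⨆ j : Finset.Ico 1 K, f j :=
  le_ciSup (f := fun j : Finset.Ico 1 K => f j) (Set.finite_range _).bddAbove ⟨k, hk⟩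

lemma norm_forecast_le_rMax {k : ℕ} (hk : k ∈ Finset.Ico 1 K) (ω : Ω) :
    ‖(X.forecast (k + 1) ω).R‖ ≤ X.rMax ω :=
  (le_iSup_episodes (fun j => ‖(X.forecast (j + 1) ω).R‖) hk).trans (le_max_right _ _)

lemma rMax_nonneg (ω : Ω) : 0 ≤ X.rMax ω :=
  (Real.iSup_nonneg fun _ => norm_nonneg _).trans (le_max_left _ _)

lemma scale_le_rMax {n : ℕ} (hn : n + 1 ≤ K) (ω : Ω) :
    X.scale (⨆ k : Finset.Ico 1 K, ‖(env (k + 1)).R‖) n ω ≤ X.rMax ω := by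
  induction n with
  | zero => exact le_max_left _ _
  | succ n ih =>
    exact max_le (ih (by lia))
      (X.norm_forecast_le_rMax (k := n + 1) (Finset.mem_Ico.2 ⟨by lia, by lia⟩) ω)

lemma sum_noise_eq_totalNoise (γ : ℝ) (ω : Ω) :
    ∑ k ∈ Finset.Ico 1 K, X.noise γ (k + 1) H ω = X.totalNoise γ (K - 1) ω := by
  rw [Finset.sum_Ico_eq_sum_range, totalNoise]
  refine Finset.sum_congr rfl fun i _ => ?_
  rw [show 1 + i + 1 = i + 2 by lia]

lemma regret_le [Nonempty A] {γ p : ℝ} (hγ₀ : 0 ≤ γ) (hγ₁ : γ < 1) (hK : 1 ≤ K)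
    (henv : ∀ k, 1 ≤ k → k ≤ K → (env k).IsMDP) {C : ℝ} {ω : Ω}
    (hC : ∀ k ∈ Finset.Ico 1 K, (X.forecast (k + 1) ω).optValueInf γ s₀ -
      (X.forecast (k + 1) ω).valueInf γ (X.policy (k + 1) ω) s₀ +
        2 * γ ^ H * X.rMax ω / (1 - γ) ≤ C)
    (hω : X.totalNoise γ (K - 1) ω ≤ X.Cp γ p ω * √((K : ℝ) - 1)) :
    X.regret γ ω ≤ X.regretI γ p ω + C * ((K : ℝ) - 1) := by
  have h1 : ∀ k ∈ Finset.Ico 1 K, (env (k + 1)).optValue γ H s₀ -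
      (env (k + 1)).value γ H (fun _ => X.policy (k + 1) ω) s₀ ≤
      ‖optModelError (env (k + 1)) (X.forecast (k + 1) ω) γ‖ / (1 - γ) -
      (∑ h ∈ Finset.range H, γ ^ h * modelError (env (k + 1)) (X.forecast (k + 1) ω) γ H
        (X.policy (k + 1) ω) h (X.state (k + 1) h ω) (X.action (k + 1) h ω)) +
      X.noise γ (k + 1) H ω + C := by
    intro k hk
    have hk' := Finset.mem_Ico.1 hk
    have h2 := episode_regret_le (henv (k + 1) (by lia) (by lia))
      (X.isSubMDP_forecast (k + 1) ω) hγ₀ hγ₁ (X.rMax_nonneg ω)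
      (fun s a => (abs_apply_le_norm _ s a).trans (X.norm_forecast_le_rMax hk ω)) H
      (X.policy (k + 1) ω) (fun h => X.state (k + 1) h ω) (fun h => X.action (k + 1) h ω)
    simp only [X.state_zero] at h2
    have h3 := hC k hk
    simp only [noise, noiseStep]
    linarith
  have h2 := Finset.sum_le_sum h1
  rw [Finset.sum_add_distrib, Finset.sum_add_distrib, Finset.sum_sub_distrib,
    Finset.sum_sub_distrib, ← Finset.sum_div, X.sum_noise_eq_totalNoise, Finset.sum_const, Nat.card_Ico, nsmul_eq_mul,
    Nat.cast_sub hK, Nat.cast_one] at h2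
  rw [regret, Finset.sum_sub_distrib, regretI, iotaInf, iotaH]
  linarith

/-- A bound on the suboptimality of the policies in the forecasted models yields a regret bound. -/
theorem regret_bound [IsProbabilityMeasure μ] [Nonempty A] {γ p : ℝ} (hγ₀ : 0 ≤ γ) (hγ₁ : γ < 1)
    (hK : 1 ≤ K) (hp₀ : 0 < p) (hp₁ : p < 1) (henv : ∀ k, 1 ≤ k → k ≤ K → (env k).IsMDP)
    {C : Ω → ℝ}
    (hC : ∀ k ∈ Finset.Ico 1 K, ∀ᵐ ω ∂μ, (X.forecast (k + 1) ω).optValueInf γ s₀ -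
      (X.forecast (k + 1) ω).valueInf γ (X.policy (k + 1) ω) s₀ +
        2 * γ ^ H * X.rMax ω / (1 - γ) ≤ C ω) :
    ENNReal.ofReal (1 - p / 2) ≤
      μ {ω | X.regret γ ω ≤ X.regretI γ p ω + C ω * ((K : ℝ) - 1)} := by
  have hγ' : 0 < 1 - γ := by linarith
  set r₀ : ℝ := ⨆ k : Finset.Ico 1 K, ‖(env (k + 1)).R‖ with hr₀
  set bad : Set Ω := {ω | 4 * X.scale r₀ (K - 1) ω / (1 - γ) * √(H * Real.log (4 / p)) *
    √((K - 1 : ℕ) : ℝ) < X.totalNoise γ (K - 1) ω} with hbad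
  have hbadμ : μ bad ≤ ENNReal.ofReal (p / 2) := by
    refine X.measure_totalNoise_gt_le hγ₀ hγ₁ hp₀ hp₁ henv
      (Real.iSup_nonneg fun _ => norm_nonneg _) (fun k hk hkK => ?_) (by lia)
    obtain ⟨k, rfl⟩ : ∃ j, k = j + 1 := ⟨k - 1, by lia⟩
    exact le_iSup_episodes (fun j => ‖(env (j + 1)).R‖) (Finset.mem_Ico.2 ⟨by lia, by lia⟩)
  have hall : ∀ᵐ ω ∂μ, ∀ k ∈ Finset.Ico 1 K, (X.forecast (k + 1) ω).optValueInf γ s₀ -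
      (X.forecast (k + 1) ω).valueInf γ (X.policy (k + 1) ω) s₀ +
        2 * γ ^ H * X.rMax ω / (1 - γ) ≤ C ω :=
    (Finset.eventually_all _).2 hC
  have hcover : ∀ᵐ ω ∂μ,
      ω ∈ bad ∪ {ω | X.regret γ ω ≤ X.regretI γ p ω + C ω * ((K : ℝ) - 1)} := by
    filter_upwards [hall] with ω hω
    by_cases hb : ω ∈ bad
    · exact .inl hb
    · refine .inr (X.regret_le hγ₀ hγ₁ hK henv hω ((not_lt.1 hb).trans ?_))
      rw [Cp, Nat.cast_sub hK, Nat.cast_one]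
      have := X.scale_le_rMax (n := K - 1) (by lia) ω
      gcongr
  -- Subadditivity of the outer measure is used instead of complements, since the regret event need
  -- not be measurable: nothing is assumed about the measurability of `C`.
  have h1 : 1 ≤ ENNReal.ofReal (p / 2) +
      μ {ω | X.regret γ ω ≤ X.regretI γ p ω + C ω * ((K : ℝ) - 1)} := by
    rw [← measure_univ (μ := μ)]
    exact (measure_mono_ae (hcover.mono fun ω h _ => h)).trans ((measure_union_le _ _).trans (add_le_add_left hbadμ _))
  rw [ENNReal.ofReal_sub _ (by positivity), ENNReal.ofReal_one]
  exact tsub_le_iff_left.2 h1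

end Interaction

end ProST

theorem theorem1 {S A Ω : Type*} [Fintype S] [Fintype A] [Nonempty A]
    [MeasurableSpace Ω] (μ : Measure Ω) [IsProbabilityMeasure μ]
    (M : ℝ → Model S A) (t : ℕ → ℝ) (K H : ℕ) (hK : 1 ≤ K)
    (hM : ∀ k, 1 ≤ k → k ≤ K → (M (t k)).IsMDP)
    (γ : ℝ) (hγ₀ : 0 ≤ γ) (hγ₁ : γ < 1) (s₀ : S)
    (X : Interaction μ (fun k => M (t k)) K H s₀)
    (init : ℕ → Ω → Policy S A)
    (hinit : ∀ k ∈ Finset.Ico 1 K, ∀ᵐ ω ∂μ, ∀ s a, 0 < (init k ω s).1 a)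
    (Δ : ℕ) (hΔ : 1 ≤ Δ) (η : ℝ) (hη : 0 < η)
    (p : ℝ) (hp₀ : 0 < p) (hp₁ : p < 1) :
    ((∀ k ∈ Finset.Ico 1 K, ∀ᵐ ω ∂μ,
        IsNPG (X.forecast (k + 1) ω) γ η Δ (init k ω) (X.policy (k + 1) ω)) →
      ENNReal.ofReal (1 - p / 2) ≤
        μ {ω | X.regret γ ω ≤ X.regretI γ p ω + X.CNPG γ η Δ init ω * ((K : ℝ) - 1)}) ∧
    (∀ τ δ : ℝ, 0 < τ → η ≤ (1 - γ) / τ →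
      (∀ k ∈ Finset.Ico 1 K, ∀ᵐ ω ∂μ,
        IsSoftNPG (X.forecast (k + 1) ω) γ η τ δ Δ (init k ω) (X.policy (k + 1) ω)) →
      ENNReal.ofReal (1 - p / 2) ≤
        μ {ω | X.regret γ ω ≤
          X.regretI γ p ω + X.CSoftNPG γ η τ δ Δ init ω * ((K : ℝ) - 1)}) := by
  have hγ' : 0 < 1 - γ := by linarith
  have hhorizon : ∀ ω, 2 * γ ^ H * X.rMax ω / (1 - γ) ≤ 4 * γ ^ H * X.rMax ω / (1 - γ) := by
    intro ω
    have := X.rMax_nonneg ω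
    gcongr
    norm_num
  refine ⟨fun h => X.regret_bound hγ₀ hγ₁ hK hp₀ hp₁ hM fun k hk => ?_,
    fun τ δ hτ hητ h => X.regret_bound hγ₀ hγ₁ hK hp₀ hp₁ hM fun k hk => ?_⟩
  · filter_upwards [hinit k hk, h k hk] with ω hpos hnpg
    have h1 := (X.isSubMDP_forecast (k + 1) ω).npg_bound hγ₀ hγ₁ hη hΔ hpos hnpg s₀
    have h2 : ‖(X.forecast (k + 1) ω).R⁺‖ + ‖(X.forecast (k + 1) ω).R⁻‖ ≤ X.rewardRange ω :=
      Interaction.le_iSup_episodes (fun j => ‖(X.forecast (j + 1) ω).R⁺‖ +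
        ‖(X.forecast (j + 1) ω).R⁻‖) hk
    have h3 := Interaction.le_iSup_episodes
      (fun j => ‖fun s a => Real.log ((init j ω s).1 a)‖) hk
    refine add_le_add (h1.trans ?_) (hhorizon ω)
    gcongr
  · filter_upwards [hinit k hk, h k hk] with ω hpos hnpg
    have hF := X.isSubMDP_forecast (k + 1) ω
    have h1 := hF.soft_npg_bound hγ₀ hγ₁ hη hτ hητ hΔ hpos hnpg s₀
    have h2 := hF.optValueInf_sub_le_of_softValue hγ₀ hγ₁ hτ.le (X.policy (k + 1) ω) s₀
    have h3 : _ ≤ X.C₁ γ η τ init ω := Interaction.le_iSup_episodes (fun j =>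
      ‖(X.forecast (j + 1) ω).optSoftQ γ τ - (X.forecast (j + 1) ω).softQ γ τ (init j ω)‖ +
      2 * τ * (1 - η * τ / (1 - γ)) *
        ‖fun s a => Real.log ((X.forecast (j + 1) ω).optSoftPolicy γ τ s a) -
          Real.log ((init j ω s).1 a)‖) hk
    have h4 : 0 ≤ 1 - η * τ := by
      have := (le_div_iff₀ hτ).1 hητ
      linarith
    have h5 := (hF.bellman_optimality hγ₀ hγ₁ τ).1 (X.policy (k + 1) ω) s₀
    set z := (1 - η * τ) ^ (Δ - 1) * X.C₁ γ η τ init ω +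
      2 * δ / (1 - γ) * (1 + γ / (η * τ)) with hz
    have h6 : (X.forecast (k + 1) ω).optSoftValue γ τ s₀ -
        (X.forecast (k + 1) ω).softValue γ τ (X.policy (k + 1) ω) s₀ ≤ z :=
      h1.trans (add_le_add_left (mul_le_mul_of_nonneg_left h3 (pow_nonneg h4 _)) _)
    -- The factor `γ + 2` is slack; `z ≥ 0` because `z` bounds a suboptimality gap. The constants
    -- `4` and `2` of the horizon and entropy terms are also twice what the argument gives.
    have h7 : z ≤ (γ + 2) * z := le_mul_of_one_le_left (by linarith) (by linarith)
    have h8 : τ * Real.log (Fintype.card A) / (1 - γ) ≤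
        2 * τ * Real.log (Fintype.card A) / (1 - γ) := by
      have := Real.log_natCast_nonneg (Fintype.card A)
      gcongr
      linarith
    have h9 := hhorizon ω
    rw [Interaction.CSoftNPG, ← hz]
    linarith
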